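/- All rings are commutative, and all modules are finitely generated. A Noetherian local ring $(R,\mathfrak m)$ is called a \emph{hypersurface} if its $\mathfrak m$-adic completion is isomorphic to $T/(f)$ for some regular local ring $T$ and some element $f$ of the maximal ideal of $T$ (so regular local rings are included). It has \emph{isolated singularity} if $R_{\mathfrak p}$ is regular for every prime ideal $\mathfrak p\neq\mathfrak m$. For a hypersurface $R$ of dimension $d$ and finitely generated $R$-modules $M,N$ such that $\operatorname{Tor}_j^R(M,N)$ has finite length for all $j\gg 0$, Hochster's theta function is $$\theta^R(M,N)=\ell\big(\operatorname{Tor}^R_{2e+2}(M,N)\big)-\ell\big(\operatorname{Tor}^R_{2e+1}(M,N)\big),$$ where $\ell$ denotes length and $e$ is any integer with $e\ge (d+2)/2$; the two lengths are finite, and the value does not depend on $e$. Theorem. Let $R$ be a hypersurface with isolated singularity and $\dim R\ge 2$, and let $M,N$ be finitely generated $R$-modules. Suppose that there is a nonzero element $x\in\operatorname{Ann}_R(M)\cap\operatorname{Ann}_R(N)$ such that $R/(x)$ is again a hypersurface with isolated singularity. Then $\theta^R(M,N)$ is defined and $\theta^R(M,N)=0$. -/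

import Mathlib

universe u

open IsLocalRing CategoryTheory

/-- A (local) hypersurface: a Noetherian local ring whose completion at the maximal ideal has the
form `T/(f)`, where `T` is a regular local ring and `f` lies in the maximal ideal of `T`
(`f = 0` is allowed). -/
class IsHypersurface (R : Type u) [CommRing R] : Prop extends
    IsLocalRing R, IsNoetherianRing R where
  completion_eq_quotient : ∃ (T : Type u) (_ : CommRing T) (_ : IsRegularLocalRing T) (f : T),
    f ∈ maximalIdeal T ∧
      Nonempty (AdicCompletion (maximalIdeal R) R ≃+* T ⧸ Ideal.span {f})

/-- The singular locus of `R`: the primes `p` such that `R_p` is not a regular local ring. -/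
def singularLocus (R : Type u) [CommRing R] : Set (PrimeSpectrum R) :=
  {p | ¬ IsRegularLocalRing (Localization.AtPrime p.asIdeal)}

/-- A ring has isolated singularity if its singular locus consists at most of maximal ideals; for
a local ring this says that the singular locus is contained in `{m}`. -/
def HasIsolatedSingularity (R : Type u) [CommRing R] : Prop :=
  ∀ p ∈ singularLocus R, p.asIdeal.IsMaximal

section Theta

variable (R : Type u) [CommRing R] (M N : Type u) [AddCommGroup M] [Module R M]
  [AddCommGroup N] [Module R N]

/-- The `R`-module `Tor_i^R(M, N)`. -/
noncomputable abbrev torModule (i : ℕ) : ModuleCat.{u} R :=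
  ((Tor (ModuleCat.{u} R) i).obj (ModuleCat.of R M)).obj (ModuleCat.of R N)

/-- The integer `l(Tor_{2e+2}^R(M, N)) - l(Tor_{2e+1}^R(M, N))`
(meaningful when both modules have finite length). -/
noncomputable def torLengthDifference (e : ℕ) : ℤ :=
  ((Module.length R (torModule R M N (2 * e + 2))).toNat : ℤ) -
    ((Module.length R (torModule R M N (2 * e + 1))).toNat : ℤ)

/-- Hochster's theta function `θ^R(M, N) = l(Tor_{2e+2}^R(M, N)) - l(Tor_{2e+1}^R(M, N))`, taken
at `e = d + 1`, where `d = dim R`. That any `e ≥ (d + 2) / 2` gives the same value, and that the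
lengths are finite, is recorded in `HochsterThetaIsDefined`. -/
noncomputable def hochsterTheta : ℤ :=
  torLengthDifference R M N (((ringKrullDim R).unbotD 0).toNat + 1)

/-- `θ^R(M, N)` is defined: all `Tor_j^R(M, N)` with `j` large have finite length, and for every
integer `e ≥ (d + 2) / 2`, where `d = dim R`, the modules `Tor_{2e+1}^R(M, N)` and
`Tor_{2e+2}^R(M, N)` have finite length, with difference of lengths equal to `θ^R(M, N)`,
independently of `e`. -/
structure HochsterThetaIsDefined : Prop where
  eventually_isFiniteLength : ∃ i : ℕ, ∀ j, i ≤ j → IsFiniteLength R (torModule R M N j)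
  isFiniteLength_odd : ∀ e : ℕ, ringKrullDim R + 2 ≤ ((2 * e : ℕ) : WithBot ℕ∞) →
    IsFiniteLength R (torModule R M N (2 * e + 1))
  isFiniteLength_even : ∀ e : ℕ, ringKrullDim R + 2 ≤ ((2 * e : ℕ) : WithBot ℕ∞) →
    IsFiniteLength R (torModule R M N (2 * e + 2))
  torLengthDifference_eq : ∀ e : ℕ, ringKrullDim R + 2 ≤ ((2 * e : ℕ) : WithBot ℕ∞) →
    torLengthDifference R M N e = hochsterTheta R M N

end Theta

/-! Write `B = R/(x)`. The element `x` is a nonzerodivisor: `R` has depth at least two and its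
localizations at primes other than the maximal ideal are regular, hence domains, so `R` is itself a
domain (`mem_nonZeroDivisors_of_isHypersurface`, by a connectedness argument on the punctured
spectrum). Since `x` is regular and kills both modules, a long exact sequence links `Tor^B_i(M,N)`,
`Tor^R_{i+1}(M,N)`, `Tor^B_{i+1}(M,N)` and `Tor^B_{i-1}(M,N)` (`exists_changeOfRings_exact`).

In high degrees `Tor` over `R` and over `B` has finite length and is periodic of period two
(`torModule_of_isHypersurface`). Finite length comes from vanishing of `Tor` over the regular
localizations. Periodicity comes from the same long exact sequence for `T → T/(f)`, as high `Tor`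
over `T` vanishes; it descends from the completion because completing does not change a module of
finite length. Only `R` is assumed to have an isolated singularity here, not its completion.

Let `p`, `r`, `u` be the lengths of `Tor^B`, of `Tor^R` and of the images of the connecting maps.
Exactness gives `p i + p (i+1) = r (i+1) + u (i+1) + u i`. If the two values of `r` differed, `u`
would decrease linearly along the even or along the odd indices, contradicting `u ≥ 0`
(`eq_of_periodic`). So consecutive high `Tor^R` modules have equal length and theta vanishes. No
compatibility of the periodicity isomorphisms with the connecting maps is needed. -/

namespace TorAux

open scoped TensorProduct MonoidalCategory

/-! ### Long exact sequence of `Tor` in the first variable -/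

section LongExact

variable {R : Type u} [CommRing R]

/-- The complex computing `Tor(M, N)` from the chosen projective resolution of `N`. -/
noncomputable abbrev torComplex (M N : ModuleCat.{u} R) : ChainComplex (ModuleCat.{u} R) ℕ :=
  (((MonoidalCategory.tensoringLeft (ModuleCat.{u} R)).obj M).mapHomologicalComplex
    (ComplexShape.down ℕ)).obj (projectiveResolution N).complex

/-- The map of complexes induced by a map in the first variable. -/
noncomputable abbrev torComplexMap {M M' : ModuleCat.{u} R} (f : M ⟶ M') (N : ModuleCat.{u} R) :
    torComplex M N ⟶ torComplex M' N :=
  (NatTrans.mapHomologicalComplex ((MonoidalCategory.tensoringLeft (ModuleCat.{u} R)).map f)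
    (ComplexShape.down ℕ)).app (projectiveResolution N).complex

/-- The homology of `torComplex` is `Tor`. -/
noncomputable def torIso (M N : ModuleCat.{u} R) (i : ℕ) :
    ((Tor (ModuleCat.{u} R) i).obj M).obj N ≅ (torComplex M N).homology i :=
  (projectiveResolution N).isoLeftDerivedObj _ i

lemma torComplexMap_comp_eq_zero {M₁ M₂ M₃ : ModuleCat.{u} R} (f : M₁ ⟶ M₂) (g : M₂ ⟶ M₃)
    (h : f ≫ g = 0) (N : ModuleCat.{u} R) : torComplexMap f N ≫ torComplexMap g N = 0 := by
  ext i : 1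
  change f ▷ _ ≫ g ▷ _ = 0
  rw [← MonoidalCategory.comp_whiskerRight, h, MonoidalPreadditive.zero_whiskerRight]

/-- The terms of the resolution of `N` are projective, hence flat, so tensoring with each of them is
exact. -/
lemma shortExact_torComplex (S : ShortComplex (ModuleCat.{u} R)) (hS : S.ShortExact)
    (N : ModuleCat.{u} R) :
    (ShortComplex.mk (torComplexMap S.f N) (torComplexMap S.g N)
      (torComplexMap_comp_eq_zero S.f S.g S.zero N)).ShortExact := by
  apply HomologicalComplex.shortExact_of_degreewise_shortExact
  intro i
  exact hS.map_of_exact (MonoidalCategory.tensorRight ((projectiveResolution N).complex.X i))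

/-- `Tor₀(M, N)` is `M ⊗ N`. -/
noncomputable def homologyZeroIso (M N : ModuleCat.{u} R) :
    (torComplex M N).homology 0 ≅ M ⊗ N :=
  ChainComplex.isoHomologyι₀ _ ≪≫ asIso ((projectiveResolution N).fromLeftDerivedZero'
    (MonoidalCategory.tensorLeft M))

lemma homologyZeroIso_naturality {M M' : ModuleCat.{u} R} (f : M ⟶ M') (N : ModuleCat.{u} R) :
    HomologicalComplex.homologyMap (torComplexMap f N) 0 ≫ (homologyZeroIso M' N).hom =
      (homologyZeroIso M N).hom ≫ f ▷ N := by
  have h : HomologicalComplex.opcyclesMap (torComplexMap f N) 0 ≫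
      (projectiveResolution N).fromLeftDerivedZero' (MonoidalCategory.tensorLeft M') =
      (projectiveResolution N).fromLeftDerivedZero' (MonoidalCategory.tensorLeft M) ≫ f ▷ N := by
    rw [← cancel_epi (HomologicalComplex.pOpcycles _ _),
      HomologicalComplex.p_opcyclesMap_assoc,
      ProjectiveResolution.pOpcycles_comp_fromLeftDerivedZero',
      ProjectiveResolution.pOpcycles_comp_fromLeftDerivedZero'_assoc]
    exact (MonoidalCategory.whisker_exchange f ((projectiveResolution N).π.f 0)).symm
  change _ ≫ HomologicalComplex.homologyι _ 0 ≫ _ = (HomologicalComplex.homologyι _ 0 ≫ _) ≫ _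
  rw [HomologicalComplex.homologyι_naturality_assoc, Category.assoc, asIso_hom, asIso_hom, h]

open Function

/-- The final clause pins down the map in degree zero; without it `Tor₁` could not be computed as
the kernel of a map of tensor products. -/
theorem exists_tor_long_exact {M₁ M₂ M₃ : Type u} [AddCommGroup M₁] [Module R M₁]
    [AddCommGroup M₂] [Module R M₂] [AddCommGroup M₃] [Module R M₃]
    {f : M₁ →ₗ[R] M₂} {g : M₂ →ₗ[R] M₃} (hf : Injective f) (hg : Surjective g)
    (h : Exact f g) (N : Type u) [AddCommGroup N] [Module R N] :
    ∃ (α : ∀ i, torModule R M₁ N i →ₗ[R] torModule R M₂ N i)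
      (β : ∀ i, torModule R M₂ N i →ₗ[R] torModule R M₃ N i)
      (δ : ∀ i, torModule R M₃ N (i + 1) →ₗ[R] torModule R M₁ N i)
      (e₁ : torModule R M₁ N 0 ≃ₗ[R] M₁ ⊗[R] N) (e₂ : torModule R M₂ N 0 ≃ₗ[R] M₂ ⊗[R] N),
      (∀ i, Exact (α i) (β i)) ∧ (∀ i, Exact (β (i + 1)) (δ i)) ∧
      (∀ i, Exact (δ i) (α i)) ∧ ∀ x, e₂ (α 0 x) = f.rTensor N (e₁ x) := by
  let S : ShortComplex (ModuleCat.{u} R) :=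
    ShortComplex.mk (ModuleCat.ofHom f) (ModuleCat.ofHom g) (by
      ext x; exact h.apply_apply_eq_zero x)
  have hS : S.ShortExact :=
    { exact := (ShortComplex.ShortExact.moduleCat_exact_iff_function_exact S).2 h
      mono_f := (ModuleCat.mono_iff_injective _).2 hf
      epi_g := (ModuleCat.epi_iff_surjective _).2 hg }
  let N' := ModuleCat.of R N
  have hT := shortExact_torComplex S hS N'
  let e (M : ModuleCat.{u} R) (i : ℕ) := (torIso M N' i).toLinearEquiv
  let a (i : ℕ) := (HomologicalComplex.homologyMap (torComplexMap S.f N') i).hom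
  let b (i : ℕ) := (HomologicalComplex.homologyMap (torComplexMap S.g N') i).hom
  let d (i : ℕ) := (hT.δ (i + 1) i rfl).hom
  have h₂ (i : ℕ) : Exact (a i) (b i) :=
    (ShortComplex.ShortExact.moduleCat_exact_iff_function_exact _).1 (hT.homology_exact₂ i)
  have h₃ (i : ℕ) : Exact (b (i + 1)) (d i) :=
    (ShortComplex.ShortExact.moduleCat_exact_iff_function_exact _).1
      (hT.homology_exact₃ (i + 1) i rfl)
  have h₁ (i : ℕ) : Exact (d i) (a i) :=
    (ShortComplex.ShortExact.moduleCat_exact_iff_function_exact _).1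
      (hT.homology_exact₁ (i + 1) i rfl)
  refine ⟨fun i ↦ (e S.X₂ i).symm.toLinearMap ∘ₗ a i ∘ₗ (e S.X₁ i).toLinearMap,
    fun i ↦ (e S.X₃ i).symm.toLinearMap ∘ₗ b i ∘ₗ (e S.X₂ i).toLinearMap,
    fun i ↦ (e S.X₁ i).symm.toLinearMap ∘ₗ d i ∘ₗ (e S.X₃ (i + 1)).toLinearMap,
    e S.X₁ 0 ≪≫ₗ (homologyZeroIso S.X₁ N').toLinearEquiv,
    e S.X₂ 0 ≪≫ₗ (homologyZeroIso S.X₂ N').toLinearEquiv, fun i ↦ ?_, fun i ↦ ?_, fun i ↦ ?_, ?_⟩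
  · exact Exact.of_ladder_linearEquiv_of_exact (e₁ := (e S.X₁ i).symm) (e₂ := (e S.X₂ i).symm)
      (e₃ := (e S.X₃ i).symm) (by ext; simp) (by ext; simp) (h₂ i)
  · exact Exact.of_ladder_linearEquiv_of_exact (e₁ := (e S.X₂ (i + 1)).symm)
      (e₂ := (e S.X₃ (i + 1)).symm) (e₃ := (e S.X₁ i).symm) (by ext; simp) (by ext; simp) (h₃ i)
  · exact Exact.of_ladder_linearEquiv_of_exact (e₁ := (e S.X₃ (i + 1)).symm)
      (e₂ := (e S.X₁ i).symm) (e₃ := (e S.X₂ i).symm) (by ext; simp) (by ext; simp) (h₁ i)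
  · intro x
    have := congr($(homologyZeroIso_naturality S.f N').hom (e S.X₁ 0 x))
    simpa using! this

theorem subsingleton_torModule_of_flat (F N : Type u) [AddCommGroup F] [Module R F]
    [AddCommGroup N] [Module R N] [Module.Flat R F] (i : ℕ) :
    Subsingleton (torModule R F N (i + 1)) := by
  have h : ((projectiveResolution (ModuleCat.of R N)).complex).ExactAt (i + 1) :=
    (projectiveResolution (ModuleCat.of R N)).complex_exactAt_succ i
  have : (torComplex (ModuleCat.of R F) (ModuleCat.of R N)).ExactAt (i + 1) := by
    rw [HomologicalComplex.exactAt_iff] at h ⊢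
    have h' := Module.Flat.lTensor_shortComplex_exact (ModuleCat.of R F) _ h
    exact h'
  have hz := (this.isZero_homology).of_iso (torIso (ModuleCat.of R F) (ModuleCat.of R N) (i + 1))
  exact ModuleCat.subsingleton_of_isZero hz

end LongExact

/-! ### Dimension shifting and finiteness -/

section Shift

variable {R : Type u} [CommRing R]

open Function

theorem torModule_congr {M M' N N' : Type u} [AddCommGroup M] [Module R M] [AddCommGroup M']
    [Module R M'] [AddCommGroup N] [Module R N] [AddCommGroup N'] [Module R N']
    (e : M ≃ₗ[R] M') (e' : N ≃ₗ[R] N') (i : ℕ) :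
    Nonempty (torModule R M N i ≃ₗ[R] torModule R M' N' i) :=
  ⟨((((Tor (ModuleCat.{u} R) i).mapIso e.toModuleIso).app (ModuleCat.of R N)) ≪≫
    ((Tor (ModuleCat.{u} R) i).obj (ModuleCat.of R M')).mapIso e'.toModuleIso).toLinearEquiv⟩

theorem torModule_zero_equiv (M N : Type u) [AddCommGroup M] [Module R M]
    [AddCommGroup N] [Module R N] : Nonempty (torModule R M N 0 ≃ₗ[R] M ⊗[R] N) :=
  ⟨(torIso (ModuleCat.of R M) (ModuleCat.of R N) 0 ≪≫ homologyZeroIso _ _).toLinearEquiv⟩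

variable {K F M : Type u} [AddCommGroup K] [Module R K] [AddCommGroup F] [Module R F]
  [AddCommGroup M] [Module R M] {f : K →ₗ[R] F} {g : F →ₗ[R] M}

theorem torModule_shift [Module.Flat R F] (hf : Injective f) (hg : Surjective g)
    (h : Exact f g) (N : Type u) [AddCommGroup N] [Module R N] (i : ℕ) :
    Nonempty (torModule R M N (i + 2) ≃ₗ[R] torModule R K N (i + 1)) := by
  obtain ⟨α, β, δ, -, -, -, h₂, h₃, -⟩ := exists_tor_long_exact hf hg h N
  have s₁ := subsingleton_torModule_of_flat (R := R) F N i
  have s₂ := subsingleton_torModule_of_flat (R := R) F N (i + 1)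
  refine ⟨LinearEquiv.ofBijective (δ (i + 1)) ⟨?_, ?_⟩⟩
  · rw [injective_iff_map_eq_zero]
    intro x hx
    obtain ⟨y, rfl⟩ := (h₂ (i + 1) x).1 hx
    rw [Subsingleton.elim y 0, map_zero]
  · intro x
    exact (h₃ (i + 1) x).1 (Subsingleton.elim _ _)

/-- This concrete model of `Tor₁` is the base case of the later inductions on degree: comparisons of
`Tor` are checked on kernels and then propagated by `torModule_shift`. -/
theorem torModule_one_equiv_ker [Module.Flat R F] (hf : Injective f) (hg : Surjective g)
    (h : Exact f g) (N : Type u) [AddCommGroup N] [Module R N] :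
    Nonempty (torModule R M N 1 ≃ₗ[R] LinearMap.ker (f.rTensor N)) := by
  obtain ⟨α, β, δ, e₁, e₂, -, h₂, h₃, he⟩ := exists_tor_long_exact hf hg h N
  have s₁ := subsingleton_torModule_of_flat (R := R) F N 0
  have hinj : Injective (e₁.toLinearMap ∘ₗ δ 0) := by
    rw [injective_iff_map_eq_zero]
    intro x hx
    obtain ⟨y, rfl⟩ := (h₂ 0 x).1 (by simpa using hx)
    rw [Subsingleton.elim y 0, map_zero]
  refine ⟨LinearEquiv.ofInjective _ hinj ≪≫ₗ LinearEquiv.ofEq _ _ ?_⟩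
  ext y
  rw [LinearMap.mem_ker, LinearMap.mem_range]
  constructor
  · rintro ⟨x, rfl⟩
    rw [LinearMap.comp_apply, LinearEquiv.coe_coe, ← he, (h₃ 0).apply_apply_eq_zero, map_zero]
  · intro hy
    obtain ⟨x, hx⟩ := (h₃ 0 (e₁.symm y)).1 (e₂.injective (by rw [he]; simpa using hy))
    exact ⟨x, by simp [hx]⟩

theorem finite_torModule [IsNoetherianRing R] (i : ℕ) : ∀ (M N : Type u) [AddCommGroup M]
    [Module R M] [Module.Finite R M] [AddCommGroup N] [Module R N] [Module.Finite R N],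
    Module.Finite R (torModule R M N i) := by
  induction i with
  | zero =>
    intro M N _ _ _ _ _ _
    obtain ⟨e⟩ := torModule_zero_equiv (R := R) M N
    exact Module.Finite.equiv e.symm
  | succ i ih =>
    intro M N _ _ _ _ _ _
    obtain ⟨n, g, hg⟩ := Module.Finite.exists_fin' R M
    have hex : Exact (LinearMap.ker g).subtype g := LinearMap.exact_subtype_ker_map g
    obtain _ | i := i
    · obtain ⟨e⟩ := torModule_one_equiv_ker (Submodule.injective_subtype _) hg hex N
      have : Module.Finite R (LinearMap.ker ((LinearMap.ker g).subtype.rTensor N)) :=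
        have := isNoetherian_of_isNoetherianRing_of_finite R (LinearMap.ker g ⊗[R] N)
        Module.Finite.of_fg (IsNoetherian.noetherian _)
      exact Module.Finite.equiv e.symm
    · obtain ⟨e⟩ := torModule_shift (Submodule.injective_subtype _) hg hex N i
      have := ih (LinearMap.ker g) N
      exact Module.Finite.equiv e.symm

end Shift

/-! ### Base change for `Tor` -/

section BaseChange

open Function

variable {A : Type u} [CommRing A] (B : Type u) [CommRing B] [Algebra A B]

/-- Linear equivalence between kernels induced by a commutative square. -/
theorem nonempty_ker_addEquiv {X X' Y Y' : Type*} [AddCommMonoid X] [AddCommMonoid X']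
    [AddCommMonoid Y] [AddCommMonoid Y'] [Module B X] [Module B X'] [Module A Y] [Module A Y']
    [Module A X] [IsScalarTower A B X]
    (φ : X →ₗ[B] X') (ψ : Y →ₗ[A] Y') (e : X ≃ₗ[A] Y) (e' : X' → Y')
    (he' : Injective e') (he₀ : e' 0 = 0) (h : ∀ x, e' (φ x) = ψ (e x)) :
    ∃ ε : LinearMap.ker φ ≃+ LinearMap.ker ψ,
      ∀ (a : A) x, ε (algebraMap A B a • x) = a • ε x := by
  refine ⟨{ toFun := fun x ↦ ⟨e x, ?_⟩, invFun := fun y ↦ ⟨e.symm y, ?_⟩, left_inv := ?_,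
            right_inv := ?_, map_add' := ?_ }, ?_⟩
  · rw [LinearMap.mem_ker, ← h, x.2, he₀]
  · rw [LinearMap.mem_ker]
    apply he'
    rw [h, e.apply_symm_apply, y.2, he₀]
  · intro x; ext; simp
  · intro x; ext; simp
  · intro x y; ext; simp
  · intro a x; ext; simp

/-- The map `(B ⊗ K) ⊗_B N ≃ K ⊗_A N`. -/
noncomputable def cancelLeft (K N : Type u) [AddCommGroup K] [Module A K] [AddCommGroup N]
    [Module A N] [Module B N] [IsScalarTower A B N] :
    (B ⊗[A] K) ⊗[B] N ≃ₗ[A] K ⊗[A] N :=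
  ((TensorProduct.comm B (B ⊗[A] K) N) ≪≫ₗ
    TensorProduct.AlgebraTensorModule.cancelBaseChange A B B N K).restrictScalars A ≪≫ₗ
    TensorProduct.comm A N K

lemma cancelLeft_rTensor {K F : Type u} (N : Type u) [AddCommGroup K] [Module A K]
    [AddCommGroup F] [Module A F] [AddCommGroup N]
    [Module A N] [Module B N] [IsScalarTower A B N] (f : K →ₗ[A] F) (x : (B ⊗[A] K) ⊗[B] N) :
    cancelLeft B F N ((f.baseChange B).rTensor N x) = f.rTensor N (cancelLeft B K N x) := by
  induction x with
  | zero => simp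
  | add x y hx hy => simp only [map_add, hx, hy]
  | tmul x n =>
    induction x with
    | zero => simp
    | add x y hx hy => simp only [map_add, hx, hy, TensorProduct.add_tmul]
    | tmul b k => simp [cancelLeft]

section Presentation

variable {K F L : Type u} [AddCommGroup K] [Module A K] [AddCommGroup F] [Module A F]
  [AddCommGroup L] [Module A L] {f : K →ₗ[A] F} {g : F →ₗ[A] L}

theorem torModule_one_baseChange_equiv_ker [Module.Flat A F] (hf : Injective (f.baseChange B))
    (hg : Surjective g) (h : Exact f g) (N : Type u) [AddCommGroup N] [Module B N] :
    Nonempty (torModule B (B ⊗[A] L) N 1 ≃ₗ[B] LinearMap.ker ((f.baseChange B).rTensor N)) :=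
  torModule_one_equiv_ker (R := B) hf (g := g.baseChange B)
    (LinearMap.lTensor_surjective B hg) (lTensor_exact B h hg) N

theorem torModule_baseChange_shift [Module.Flat A F] (hf : Injective (f.baseChange B))
    (hg : Surjective g) (h : Exact f g) (N : Type u) [AddCommGroup N] [Module B N] (i : ℕ) :
    Nonempty (torModule B (B ⊗[A] L) N (i + 2) ≃ₗ[B] torModule B (B ⊗[A] K) N (i + 1)) :=
  torModule_shift (R := B) hf (g := g.baseChange B)
    (LinearMap.lTensor_surjective B hg) (lTensor_exact B h hg) N i

/-- Both sides are kernels of the same map after cancelling `B`. They are modules over different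
rings, hence an additive equivalence that is semilinear along `algebraMap A B`. -/
theorem torModule_one_baseChange_addEquiv [Module.Flat A F] (hf : Injective f)
    (hfB : Injective (f.baseChange B)) (hg : Surjective g) (h : Exact f g)
    (N : Type u) [AddCommGroup N] [Module A N] [Module B N] [IsScalarTower A B N] :
    ∃ ε : torModule B (B ⊗[A] L) N 1 ≃+ torModule A L N 1,
      ∀ (a : A) x, ε (algebraMap A B a • x) = a • ε x := by
  obtain ⟨e₁⟩ := torModule_one_equiv_ker hf hg h N
  obtain ⟨e₂⟩ := torModule_one_baseChange_equiv_ker B hfB hg h N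
  obtain ⟨ε, hε⟩ := nonempty_ker_addEquiv B ((f.baseChange B).rTensor N) (f.rTensor N)
    (cancelLeft B K N) (cancelLeft B F N) (cancelLeft B F N).injective (map_zero _)
    (cancelLeft_rTensor B N f)
  refine ⟨e₂.toAddEquiv.trans (ε.trans e₁.symm.toAddEquiv), fun a x ↦ ?_⟩
  change e₁.symm (ε (e₂ (algebraMap A B a • x))) = a • e₁.symm (ε (e₂ x))
  rw [map_smul, hε, map_smul]

theorem torModule_one_flat_baseChange [Module.Flat A B] [Module.Flat A F] (hf : Injective f)
    (hg : Surjective g) (h : Exact f g) (N : Type u) [AddCommGroup N] [Module A N] :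
    Nonempty (torModule B (B ⊗[A] L) (B ⊗[A] N) 1 ≃ₗ[B] B ⊗[A] torModule A L N 1) := by
  obtain ⟨e₁⟩ := torModule_one_equiv_ker hf hg h N
  obtain ⟨e₂⟩ := torModule_one_baseChange_equiv_ker B
    (Module.Flat.lTensor_preserves_injective_linearMap f hf) hg h (B ⊗[A] N)
  let dK := TensorProduct.AlgebraTensorModule.distribBaseChange A B K N
  let dF := TensorProduct.AlgebraTensorModule.distribBaseChange A B F N
  have hd (x) : dF ((f.rTensor N).baseChange B x) = (f.baseChange B).rTensor (B ⊗[A] N) (dK x) := by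
    induction x with
    | zero => simp
    | add x y hx hy => simp only [map_add, hx, hy]
    | tmul b y =>
      induction y with
      | zero => simp
      | add x y hx hy => simp only [map_add, hx, hy, TensorProduct.tmul_add]
      | tmul k n => simp [dK, dF]
  obtain ⟨ε, hε⟩ := nonempty_ker_addEquiv (A := B) B ((f.rTensor N).baseChange B)
    ((f.baseChange B).rTensor (B ⊗[A] N)) dK dF dF.injective (map_zero _) hd
  let ε' : LinearMap.ker ((f.rTensor N).baseChange B) ≃ₗ[B]
      LinearMap.ker ((f.baseChange B).rTensor (B ⊗[A] N)) :=
    { ε with map_smul' := hε }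
  exact ⟨e₂ ≪≫ₗ ε'.symm ≪≫ₗ (LinearMap.tensorKerEquiv B B (f.rTensor N)).symm ≪≫ₗ
    (e₁.symm.baseChange A B _ _)⟩

end Presentation

/-- The standard first syzygy of a module. -/
abbrev Syzygy (L : Type u) [AddCommGroup L] [Module A L] : Type u :=
  LinearMap.ker (Finsupp.linearCombination A (id : L → L))

/-- `P` is any class of modules closed under syzygies whose standard presentations stay injective
after base change, so that shifting works over `A` and `B` in parallel. The class used below is that
of modules on which `x` is regular. -/
theorem torModule_baseChange_addEquiv
    (P : ∀ (L : Type u) [AddCommGroup L] [Module A L], Prop)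
    (hP : ∀ (L : Type u) [AddCommGroup L] [Module A L], P L → P (Syzygy (A := A) L))
    (hinj : ∀ (L : Type u) [AddCommGroup L] [Module A L], P L → Injective
      ((LinearMap.ker (Finsupp.linearCombination A (id : L → L))).subtype.baseChange B))
    (N : Type u) [AddCommGroup N] [Module A N] [Module B N] [IsScalarTower A B N] (i : ℕ) :
    ∀ (L : Type u) [AddCommGroup L] [Module A L], P L →
      ∃ ε : torModule B (B ⊗[A] L) N (i + 1) ≃+ torModule A L N (i + 1),
        ∀ (a : A) x, ε (algebraMap A B a • x) = a • ε x := by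
  induction i with
  | zero =>
    intro L _ _ hL
    exact torModule_one_baseChange_addEquiv B (Submodule.injective_subtype _) (hinj L hL)
      (Finsupp.linearCombination_id_surjective A L) (LinearMap.exact_subtype_ker_map _) N
  | succ i ih =>
    intro L _ _ hL
    obtain ⟨e₁⟩ := torModule_shift (Submodule.injective_subtype _)
      (Finsupp.linearCombination_id_surjective A L) (LinearMap.exact_subtype_ker_map _) N i
    obtain ⟨e₂⟩ := torModule_baseChange_shift B (hinj L hL)
      (Finsupp.linearCombination_id_surjective A L) (LinearMap.exact_subtype_ker_map _) N i
    obtain ⟨ε, hε⟩ := ih _ (hP L hL)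
    refine ⟨e₂.toAddEquiv.trans (ε.trans e₁.symm.toAddEquiv), fun a x ↦ ?_⟩
    change e₁.symm (ε (e₂ (algebraMap A B a • x))) = a • e₁.symm (ε (e₂ x))
    rw [map_smul, hε, map_smul]

theorem torModule_flat_baseChange [Module.Flat A B] (i : ℕ) :
    ∀ (L N : Type u) [AddCommGroup L] [Module A L] [AddCommGroup N] [Module A N],
      Nonempty (torModule B (B ⊗[A] L) (B ⊗[A] N) (i + 1) ≃ₗ[B]
        B ⊗[A] torModule A L N (i + 1)) := by
  induction i with
  | zero =>
    intro L N _ _ _ _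
    exact torModule_one_flat_baseChange B (Submodule.injective_subtype _)
      (Finsupp.linearCombination_id_surjective A L) (LinearMap.exact_subtype_ker_map _) N
  | succ i ih =>
    intro L N _ _ _ _
    obtain ⟨e₁⟩ := torModule_shift (Submodule.injective_subtype _)
      (Finsupp.linearCombination_id_surjective A L) (LinearMap.exact_subtype_ker_map _) N i
    have hinj : Injective ((LinearMap.ker (Finsupp.linearCombination A
        (id : L → L))).subtype.baseChange B) :=
      Module.Flat.lTensor_preserves_injective_linearMap _ (Submodule.injective_subtype _)
    obtain ⟨e₂⟩ := torModule_baseChange_shift B hinj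
      (Finsupp.linearCombination_id_surjective A L) (LinearMap.exact_subtype_ker_map _)
      (B ⊗[A] N) i
    obtain ⟨ε⟩ := ih (Syzygy (A := A) L) N
    exact ⟨e₂ ≪≫ₗ ε ≪≫ₗ (e₁.symm.baseChange A B _ _)⟩

end BaseChange

/-! ### Change of rings along `A → A/(x)` -/

section ChangeOfRings

open Function

variable {A : Type u} [CommRing A] {B : Type u} [CommRing B] [Algebra A B] {x : A}

lemma one_tmul_eq_zero_iff (hs : Surjective (algebraMap A B))
    (hk : RingHom.ker (algebraMap A B) = Ideal.span {x}) {L : Type u} [AddCommGroup L] [Module A L]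
    (l : L) : (1 : B) ⊗ₜ[A] l = 0 ↔ ∃ l' : L, l = x • l' := by
  have hk' : Ideal.span {x} = RingHom.ker (Algebra.ofId A B) := hk.symm
  let e' : (A ⧸ Ideal.span {x}) ≃ₐ[A] B := (Ideal.quotientEquivAlgOfEq A hk').trans
    (Ideal.quotientKerAlgEquivOfSurjective (f := Algebra.ofId A B) hs)
  let e : (A ⧸ Ideal.span {x}) ≃ₗ[A] B := e'.toLinearEquiv
  have he : e 1 = 1 := map_one e'
  have h1 : (1 : B) ⊗ₜ[A] l = e.rTensor L (1 ⊗ₜ l) := by simp [he]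
  rw [h1, LinearEquiv.map_eq_zero_iff,
    ← (TensorProduct.quotTensorEquivQuotSMul L (Ideal.span {x})).map_eq_zero_iff,
    TensorProduct.quotTensorEquivQuotSMul_mk_one_tmul, Submodule.Quotient.mk_eq_zero,
    Submodule.ideal_span_singleton_smul, Submodule.mem_smul_pointwise_iff_exists]
  simp [eq_comm]

variable {K F L : Type u} [AddCommGroup K] [Module A K] [AddCommGroup F] [Module A F]
  [AddCommGroup L] [Module A L] {f : K →ₗ[A] F} {g : F →ₗ[A] L}

/-- This is the vanishing of `Tor₁(A/(x), L)`, checked by hand: if `f k = x φ`, then `x` kills `g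
φ`, so `φ` lifts to `K`. -/
lemma baseChange_injective_of_isSMulRegular (hs : Surjective (algebraMap A B))
    (hk : RingHom.ker (algebraMap A B) = Ideal.span {x}) (hx : IsSMulRegular L x)
    (hf : Injective f) (h : Exact f g) : Injective (f.baseChange B) := by
  rw [injective_iff_map_eq_zero]
  intro z hz
  obtain ⟨k, rfl⟩ := TensorProduct.mk_surjective A K B hs z
  simp only [TensorProduct.mk_apply, LinearMap.baseChange_tmul] at hz ⊢
  rw [one_tmul_eq_zero_iff hs hk] at hz ⊢
  obtain ⟨φ, hφ⟩ := hz
  have : g φ = 0 := by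
    apply hx
    simp only [smul_zero]
    rw [← map_smul, ← hφ, h.apply_apply_eq_zero]
  obtain ⟨k', rfl⟩ := (h φ).1 this
  exact ⟨k', hf (by rw [hφ, map_smul])⟩

theorem torModule_addEquiv_of_isSMulRegular (hs : Surjective (algebraMap A B))
    (hk : RingHom.ker (algebraMap A B) = Ideal.span {x}) (hxA : IsSMulRegular A x)
    (hx : IsSMulRegular L x)
    (N : Type u) [AddCommGroup N] [Module A N] [Module B N] [IsScalarTower A B N] (i : ℕ) :
    ∃ ε : torModule B (B ⊗[A] L) N (i + 1) ≃+ torModule A L N (i + 1),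
        ∀ (a : A) x, ε (algebraMap A B a • x) = a • ε x := by
  refine torModule_baseChange_addEquiv B (fun L _ _ ↦ IsSMulRegular L x) ?_ ?_ N i L hx
  · intro L _ _ hL
    have : IsSMulRegular (L →₀ A) x := fun a b hab ↦ by
      ext l
      exact hxA (DFunLike.congr_fun hab l)
    exact this.submodule _ x
  · intro L _ _ hL
    exact baseChange_injective_of_isSMulRegular hs hk hL (Submodule.injective_subtype _)
      (LinearMap.exact_subtype_ker_map (Finsupp.linearCombination A (id : L → L)))

section SES

/-- The class of `x φ` modulo `x · ker g` depends only on `g φ`, which makes `toBaseChangeKer`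
additive and linear although it is defined by a chosen section. -/
lemma one_tmul_smul_eq (hs : Surjective (algebraMap A B))
    (hk : RingHom.ker (algebraMap A B) = Ideal.span {x}) {M : Type u} [AddCommGroup M]
    [Module A M] {g : F →ₗ[A] M} {φ ψ : F}
    (h : g φ = g ψ) (h₁ : x • φ ∈ LinearMap.ker g) (h₂ : x • ψ ∈ LinearMap.ker g) :
    (1 : B) ⊗ₜ[A] (⟨x • φ, h₁⟩ : LinearMap.ker g) = 1 ⊗ₜ[A] ⟨x • ψ, h₂⟩ := by
  rw [← sub_eq_zero, ← TensorProduct.tmul_sub, one_tmul_eq_zero_iff hs hk]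
  exact ⟨⟨φ - ψ, by simp [h]⟩, by ext; simp [smul_sub]⟩

variable {M : Type u} [AddCommGroup M] [Module A M] [Module B M] [IsScalarTower A B M]

lemma smul_eq_zero_of_ker (hk : RingHom.ker (algebraMap A B) = Ideal.span {x}) (m : M) :
    x • m = 0 := by
  have : algebraMap A B x = 0 := by
    rw [← RingHom.mem_ker, hk]; exact Ideal.mem_span_singleton_self x
  rw [← algebraMap_smul B, this, zero_smul]

/-- The map `M → B ⊗ L`, `g φ ↦ 1 ⊗ x φ`, where `L` is the kernel of a surjection `g : F → M`. -/
noncomputable def toBaseChangeKer (hs : Surjective (algebraMap A B))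
    (hk : RingHom.ker (algebraMap A B) = Ideal.span {x}) {g : F →ₗ[A] M} (hg : Surjective g) :
    M →ₗ[B] B ⊗[A] LinearMap.ker g where
  toFun m := 1 ⊗ₜ ⟨x • surjInv hg m, by simp [smul_eq_zero_of_ker hk]⟩
  map_add' m m' := by
    rw [← TensorProduct.tmul_add]
    refine (one_tmul_smul_eq hs hk (ψ := surjInv hg m + surjInv hg m') ?_ _ ?_).trans ?_
    · simp [surjInv_eq]
    · simp [smul_eq_zero_of_ker hk]
    · congr 1; ext; simp
  map_smul' b m := by
    obtain ⟨a, rfl⟩ := hs b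
    refine (one_tmul_smul_eq hs hk (ψ := a • surjInv hg m) ?_ _ ?_).trans ?_
    · simp [surjInv_eq]
    · simp [smul_eq_zero_of_ker hk]
    · rw [RingHom.id_apply, algebraMap_smul, ← TensorProduct.tmul_smul]
      congr 1; ext; simp [smul_comm x a]

lemma toBaseChangeKer_apply (hs : Surjective (algebraMap A B))
    (hk : RingHom.ker (algebraMap A B) = Ideal.span {x}) {g : F →ₗ[A] M} (hg : Surjective g)
    (φ : F) : toBaseChangeKer hs hk hg (g φ) =
      1 ⊗ₜ ⟨x • φ, by simp [smul_eq_zero_of_ker hk]⟩ :=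
  one_tmul_smul_eq hs hk (surjInv_eq hg _) _ _

lemma toBaseChangeKer_injective (hs : Surjective (algebraMap A B))
    (hk : RingHom.ker (algebraMap A B) = Ideal.span {x}) (hx : IsSMulRegular F x)
    {g : F →ₗ[A] M} (hg : Surjective g) : Injective (toBaseChangeKer hs hk hg) := by
  rw [injective_iff_map_eq_zero]
  intro m hm
  obtain ⟨φ, rfl⟩ := hg m
  rw [toBaseChangeKer_apply, one_tmul_eq_zero_iff hs hk] at hm
  obtain ⟨l, hl⟩ := hm
  have : φ = l := hx (congrArg Subtype.val hl)
  rw [this]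
  exact l.2

/-- The map from `B ⊗ L` to the kernel of `B ⊗ F → M`. -/
noncomputable def baseChangeKerToKer (B : Type u) [CommRing B] [Algebra A B] [Module B M]
    [IsScalarTower A B M] (g : F →ₗ[A] M) :
    B ⊗[A] LinearMap.ker g →ₗ[B] LinearMap.ker (g.liftBaseChange B) :=
  ((LinearMap.ker g).subtype.baseChange B).codRestrict _ fun z ↦ by
    rw [LinearMap.mem_ker]
    induction z with
    | zero => simp
    | add y z hy hz => rw [map_add, map_add, hy, hz, add_zero]
    | tmul b l => simp

lemma liftBaseChange_surjective {g : F →ₗ[A] M} (hg : Surjective g) :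
    Surjective (g.liftBaseChange B) := by
  intro m
  obtain ⟨φ, rfl⟩ := hg m
  exact ⟨1 ⊗ₜ φ, by simp⟩

lemma baseChangeKerToKer_surjective (hs : Surjective (algebraMap A B)) (g : F →ₗ[A] M) :
    Surjective (baseChangeKerToKer B g) := by
  rintro ⟨z, hz⟩
  obtain ⟨φ, rfl⟩ := TensorProduct.mk_surjective A F B hs z
  exact ⟨1 ⊗ₜ ⟨φ, by simpa using hz⟩, by ext; simp [baseChangeKerToKer]⟩

lemma exact_toBaseChangeKer (hs : Surjective (algebraMap A B))
    (hk : RingHom.ker (algebraMap A B) = Ideal.span {x}) {g : F →ₗ[A] M} (hg : Surjective g) :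
    Exact (toBaseChangeKer hs hk hg) (baseChangeKerToKer B g) := by
  intro z
  obtain ⟨l, rfl⟩ := TensorProduct.mk_surjective A _ B hs z
  have h : baseChangeKerToKer B g (1 ⊗ₜ l) = 0 ↔ (1 : B) ⊗ₜ[A] (l : F) = 0 := by
    rw [Subtype.ext_iff]; simp [baseChangeKerToKer]
  rw [TensorProduct.mk_apply, h, one_tmul_eq_zero_iff hs hk]
  constructor
  · rintro ⟨φ, hφ⟩
    exact ⟨g φ, by rw [toBaseChangeKer_apply]; congr 1; ext; exact hφ.symm⟩
  · rintro ⟨m, hm⟩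
    obtain ⟨φ, rfl⟩ := hg m
    rw [toBaseChangeKer_apply, ← sub_eq_zero, ← TensorProduct.tmul_sub,
      one_tmul_eq_zero_iff hs hk] at hm
    obtain ⟨l', hl'⟩ := hm
    refine ⟨φ - l', ?_⟩
    have := congrArg Subtype.val hl'
    simp only [AddSubgroupClass.coe_sub, SetLike.val_smul] at this
    rw [smul_sub, ← this, sub_sub_cancel]

/-- The long exact sequence relating `Tor` over `A` and over `B = A / (x)`. -/
theorem exists_changeOfRings_exact (hs : Surjective (algebraMap A B))
    (hk : RingHom.ker (algebraMap A B) = Ideal.span {x}) (hx : IsSMulRegular A x)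
    (M N : Type u) [AddCommGroup M] [Module A M] [Module B M] [IsScalarTower A B M]
    [AddCommGroup N] [Module A N] [Module B N] [IsScalarTower A B N] :
    ∃ (X : ℕ → ModuleCat.{u} B) (ε : ∀ i, X i ≃+ torModule A M N (i + 2))
      (α : ∀ i, torModule B M N (i + 1) →ₗ[B] X i)
      (β : ∀ i, X i →ₗ[B] torModule B M N (i + 2))
      (δ : ∀ i, torModule B M N (i + 3) →ₗ[B] torModule B M N (i + 1)),
      (∀ i (a : A) y, ε i (algebraMap A B a • y) = a • ε i y) ∧ (∀ i, Exact (α i) (β i)) ∧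
      (∀ i, Exact (β (i + 1)) (δ i)) ∧ ∀ i, Exact (δ i) (α i) := by
  let g := Finsupp.linearCombination A (id : M → M)
  have hg : Surjective g := Finsupp.linearCombination_id_surjective A M
  have hxF : IsSMulRegular (M →₀ A) x := fun a b hab ↦ by
    ext l
    exact hx (DFunLike.congr_fun hab l)
  -- With `F → M` free and `L` its kernel, take the `Tor^B` sequence of `0 → M → L/xL → ker (F/xF →
  -- M) → 0`. The middle term gives `Tor^A(L, N)`, since `x` is regular on `L`, hence `Tor^A(M, N)`
  -- one degree higher; the right term is a syzygy of `M` over `B`.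
  obtain ⟨α, β, δ, -, -, h₁, h₂, h₃, -⟩ := exists_tor_long_exact (R := B)
    (M₁ := M) (M₂ := B ⊗[A] LinearMap.ker g) (M₃ := LinearMap.ker (g.liftBaseChange B))
    (f := toBaseChangeKer hs hk hg) (g := baseChangeKerToKer B g)
    (toBaseChangeKer_injective hs hk hxF hg) (baseChangeKerToKer_surjective hs g)
    (exact_toBaseChangeKer hs hk hg) N
  choose ε hε using fun i ↦ torModule_addEquiv_of_isSMulRegular
    (L := LinearMap.ker g) hs hk hx (hxF.submodule (LinearMap.ker g) x) N i
  have σ (i : ℕ) := Classical.choice (torModule_shift (R := A) (Submodule.injective_subtype _) hg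
    (LinearMap.exact_subtype_ker_map g) N i)
  have τ (i : ℕ) := Classical.choice (torModule_shift (R := B) (Submodule.injective_subtype _)
    (liftBaseChange_surjective (B := B) hg)
    (LinearMap.exact_subtype_ker_map (g.liftBaseChange B)) N i)
  refine ⟨fun i ↦ torModule B (B ⊗[A] LinearMap.ker g) N (i + 1),
    fun i ↦ (ε i).trans (σ i).symm.toAddEquiv, fun i ↦ α (i + 1),
    fun i ↦ (τ i).symm.toLinearMap ∘ₗ β (i + 1),
    fun i ↦ δ (i + 1) ∘ₗ (τ (i + 1)).toLinearMap, ?_, ?_, ?_, ?_⟩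
  · intro i a y
    change (σ i).symm (ε i _) = a • (σ i).symm (ε i y)
    rw [hε, map_smul]
  · intro i y
    rw [← h₁ (i + 1) y]
    simp
  · intro i y
    rw [LinearMap.comp_apply, LinearEquiv.coe_coe, h₂ (i + 1) (τ (i + 1) y)]
    constructor
    · rintro ⟨z, hz⟩
      exact ⟨z, by simp [hz]⟩
    · rintro ⟨z, rfl⟩
      exact ⟨z, by simp⟩
  · intro i y
    rw [h₃ (i + 1) y]
    constructor
    · rintro ⟨z, hz⟩
      exact ⟨(τ (i + 1)).symm z, by simp [hz]⟩
    · rintro ⟨z, rfl⟩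
      exact ⟨τ (i + 1) z, by simp⟩

end SES

end ChangeOfRings

/-! ### Regular local rings: hyperplane sections and integrality -/

section Regular

open Function

/-- Write `t` in the generators. Some coefficient is a unit, since otherwise `t` lies in the square
of the maximal ideal; the corresponding generator can be exchanged for `t`. -/
lemma maximalIdeal_le_span_insert {T : Type*} [CommRing T] [IsLocalRing T] {t : T}
    (ht' : t ∉ maximalIdeal T ^ 2) (G : Finset T) (hG : Ideal.span (G : Set T) = maximalIdeal T)
    (ht : t ∈ maximalIdeal T) :
    ∃ g ∈ G, maximalIdeal T ≤ Ideal.span {t} ⊔ Ideal.span ((G : Set T) \ {g}) := by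
  classical
  rw [← hG] at ht
  obtain ⟨a, -, ha⟩ := Submodule.mem_span_finset.1 ht
  have : ∃ g ∈ G, a g ∉ maximalIdeal T := by
    by_contra! h
    apply ht'
    rw [← ha, pow_two]
    exact Ideal.sum_mem _ fun g hg ↦
      Ideal.mul_mem_mul (h g hg) (hG ▸ Ideal.subset_span (Finset.mem_coe.2 hg))
  obtain ⟨g, hg, hu⟩ := this
  refine ⟨g, hg, ?_⟩
  rw [← hG, Ideal.span_le]
  set J := Ideal.span {t} ⊔ Ideal.span ((G : Set T) \ {g}) with hJ
  have h₁ : ∀ g' ∈ G, g' ≠ g → g' ∈ J := fun g' hg' hne ↦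
    Ideal.mem_sup_right (Ideal.subset_span ⟨hg', hne⟩)
  intro g' hg'
  by_cases hne : g' = g
  · subst hne
    have hunit : IsUnit (a g') := by simpa using hu
    have : a g' * g' = t - ∑ x ∈ G.erase g', a x • x := by
      rw [← ha, ← Finset.add_sum_erase G _ hg]; simp
    have h₂ : a g' * g' ∈ J := by
      rw [this]
      refine J.sub_mem (Ideal.mem_sup_left (Ideal.mem_span_singleton_self t)) ?_
      exact Ideal.sum_mem _ fun x hx ↦
        J.mul_mem_left _ (h₁ x (Finset.mem_of_mem_erase hx) (Finset.ne_of_mem_erase hx))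
    exact (Ideal.unit_mul_mem_iff_mem J hunit).1 h₂
  · exact h₁ g' hg' hne

lemma isLocalRing_quotient {T : Type*} [CommRing T] [IsLocalRing T] {t : T}
    (ht : t ∈ maximalIdeal T) : IsLocalRing (T ⧸ Ideal.span {t}) := by
  have : Nontrivial (T ⧸ Ideal.span {t}) := Ideal.Quotient.nontrivial_iff.2 fun h ↦
    (maximalIdeal.isMaximal T).ne_top (top_le_iff.1 (h ▸ (Ideal.span_singleton_le_iff_mem _).2 ht))
  exact IsLocalRing.of_surjective' (Ideal.Quotient.mk _) Ideal.Quotient.mk_surjective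

/-- The exchanged generators bound the embedding dimension by `n`, while killing one element lowers
the dimension by at most one. The two bounds meet. -/
theorem isRegularLocalRing_quotient {T : Type*} [CommRing T] [IsRegularLocalRing T] {n : ℕ}
    (hn : ringKrullDim T = (n + 1 : ℕ)) {t : T} (ht : t ∈ maximalIdeal T)
    (ht' : t ∉ maximalIdeal T ^ 2) :
    IsRegularLocalRing (T ⧸ Ideal.span {t}) ∧ ringKrullDim (T ⧸ Ideal.span {t}) = n := by
  classical
  have := isLocalRing_quotient ht
  have hfg : (maximalIdeal T).FG := IsNoetherian.noetherian _
  have hfin := Submodule.FG.finite_generators hfg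
  have hcard : hfin.toFinset.card = n + 1 := by
    have h := IsRegularLocalRing.spanFinrank_maximalIdeal (R := T)
    rw [hn, ← Submodule.FG.generators_ncard hfg, Set.ncard_eq_toFinset_card _ hfin] at h
    exact_mod_cast h
  obtain ⟨g, hg, hle⟩ := maximalIdeal_le_span_insert ht' hfin.toFinset
    (by rw [Set.Finite.coe_toFinset]; exact (maximalIdeal T).span_generators) ht
  have hS : (maximalIdeal (T ⧸ Ideal.span {t})).spanFinrank ≤ n := by
    have hmap : maximalIdeal (T ⧸ Ideal.span {t}) =
        Ideal.span ((hfin.toFinset.erase g).image (Ideal.Quotient.mk (Ideal.span {t})) :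
          Finset (T ⧸ Ideal.span {t})) := by
      apply le_antisymm
      · intro y hy
        obtain ⟨y, rfl⟩ := Ideal.Quotient.mk_surjective y
        have hy' : y ∈ maximalIdeal T := by
          rw [mem_maximalIdeal, mem_nonunits_iff] at hy ⊢
          exact fun h ↦ hy (h.map _)
        obtain ⟨a, ha, b, hb, rfl⟩ := Submodule.mem_sup.1 (hle hy')
        rw [map_add, Ideal.Quotient.eq_zero_iff_mem.2 ha, zero_add, Finset.coe_image,
          ← Ideal.map_span]
        apply Ideal.mem_map_of_mem
        simpa using hb
      · rw [Ideal.span_le]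
        intro y hy
        obtain ⟨z, hz, rfl⟩ := Finset.mem_image.1 (Finset.mem_coe.1 hy)
        have hz' : z ∈ maximalIdeal T := by
          rw [← (maximalIdeal T).span_generators]
          exact Submodule.subset_span (by simpa using Finset.mem_of_mem_erase hz)
        have hmk : IsLocalHom (Ideal.Quotient.mk (Ideal.span {t})) :=
          .of_surjective _ Ideal.Quotient.mk_surjective
        rw [SetLike.mem_coe, mem_maximalIdeal, mem_nonunits_iff] at *
        exact fun h ↦ hz' (isUnit_of_map_unit _ _ h)
    rw [hmap]
    refine (Submodule.spanFinrank_span_le_ncard_of_finite (Finset.finite_toSet _)).trans ?_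
    rw [Set.ncard_coe_finset]
    refine Finset.card_image_le.trans ?_
    rw [Finset.card_erase_of_mem hg, hcard, Nat.add_sub_cancel]
  have h₁ : ringKrullDim (T ⧸ Ideal.span {t}) ≤ n :=
    (ringKrullDim_le_spanFinrank_maximalIdeal _).trans (by exact_mod_cast hS)
  have h₂ : (n : WithBot ℕ∞) ≤ ringKrullDim (T ⧸ Ideal.span {t}) := by
    have h := ringKrullDim_le_ringKrullDim_quotient_add_encard (R := T) {t}
      (by simpa [IsLocalRing.ringJacobson_eq_maximalIdeal] using ht)
    rw [hn, Set.encard_singleton] at h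
    simp only [Nat.cast_add, Nat.cast_one, WithBot.coe_one] at h
    exact ENat.WithBot.add_le_add_one_right_iff.1 h
  have h₃ := le_antisymm h₁ h₂
  refine ⟨IsRegularLocalRing.of_spanFinrank_maximalIdeal_le _ ?_, h₃⟩
  rw [h₃]
  exact_mod_cast hS

lemma exists_mem_maximalIdeal_notMem_sq {T : Type*} [CommRing T] [IsLocalRing T]
    [IsNoetherianRing T] (hT : 0 < ringKrullDim T) :
    ∃ t ∈ maximalIdeal T, t ∉ maximalIdeal T ^ 2 ∧ ∀ p ∈ minimalPrimes T, t ∉ p := by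
  by_contra! h
  have hfin := minimalPrimes.finite_of_isNoetherianRing T
  -- Prime avoidance tolerates two ideals that need not be prime; the square of the maximal ideal
  -- fills both slots.
  have hsub : ((maximalIdeal T : Ideal T) : Set T) ⊆ (id (maximalIdeal T ^ 2) : Ideal T) ∪
      (id (maximalIdeal T ^ 2) : Ideal T) ∪
      ⋃ i ∈ (↑hfin.toFinset : Set (Ideal T)), (id i : Ideal T) := by
    intro t ht
    by_cases h2 : t ∈ maximalIdeal T ^ 2
    · exact Or.inl (Or.inl h2)
    · obtain ⟨p, hp, htp⟩ := h t ht h2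
      exact Or.inr (Set.mem_biUnion (by simpa using hp) htp)
  have hh := IsLocalRing.maximalIdeal_height_eq_ringKrullDim (R := T)
  have key : ∀ p ∈ minimalPrimes T, ¬ maximalIdeal T ≤ p := by
    intro p hp hle
    have hp' : p.IsPrime := hp.1.1
    have heq : maximalIdeal T = p := (maximalIdeal.isMaximal T).eq_of_le hp'.ne_top hle
    have : (maximalIdeal T).height = 0 := by
      rw [heq]; exact Ideal.height_eq_zero_iff.2 hp
    rw [← hh, this] at hT
    exact absurd hT (by simp)
  have hsq : ¬ maximalIdeal T ≤ maximalIdeal T ^ 2 := by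
    intro hle
    have hbot : maximalIdeal T = ⊥ := by
      refine Submodule.eq_bot_of_le_smul_of_le_jacobson_bot (maximalIdeal T) _
        (IsNoetherian.noetherian _) (by rwa [smul_eq_mul, ← pow_two])
        (IsLocalRing.maximalIdeal_le_jacobson _)
    obtain ⟨p, hp⟩ := Ideal.nonempty_minimalPrimes (I := (⊥ : Ideal T)) bot_ne_top
    exact key p hp (hbot ▸ bot_le)
  rcases (Ideal.subset_union_prime' (s := hfin.toFinset) (f := id) fun p hp ↦
    (show p ∈ minimalPrimes T by simpa using hp).1.1).1 hsub with h | h | ⟨p, hp, h⟩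
  · exact hsq h
  · exact hsq h
  · exact key p (by simpa using hp) h

theorem isDomain_of_isRegularLocalRing_of_ringKrullDim_eq (n : ℕ) : ∀ (T : Type u) [CommRing T]
    [IsRegularLocalRing T], ringKrullDim T = n → IsDomain T := by
  induction n with
  | zero =>
    intro T _ _ hn
    have h := IsRegularLocalRing.spanFinrank_maximalIdeal (R := T)
    rw [hn] at h
    have hbot : maximalIdeal T = ⊥ :=
      (Submodule.spanFinrank_eq_zero_iff_eq_bot (IsNoetherian.noetherian _)).1 (by exact_mod_cast h)
    exact (IsLocalRing.isField_iff_maximalIdeal_eq.2 hbot).isDomain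
  | succ n ih =>
    intro T _ _ hn
    obtain ⟨t, ht, ht2, htp⟩ := exists_mem_maximalIdeal_notMem_sq (T := T) (by
      rw [hn]; exact_mod_cast Nat.succ_pos n)
    obtain ⟨hreg, hdim⟩ := isRegularLocalRing_quotient hn ht ht2
    have hdom := ih (T ⧸ Ideal.span {t}) hdim
    have hprime : (Ideal.span {t}).IsPrime := (Ideal.Quotient.isDomain_iff_prime _).1 hdom
    obtain ⟨p, hp, hpt⟩ := Ideal.exists_minimalPrimes_le (I := (⊥ : Ideal T)) (J := Ideal.span {t})
      bot_le
    have hp' : p.IsPrime := hp.1.1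
    -- The minimal prime `p` lies in the prime `(t)` but does not contain `t`, so `p = t p`, and
    -- Nakayama gives `p = 0`.
    have hpbot : p = ⊥ := by
      refine Submodule.eq_bot_of_le_smul_of_le_jacobson_bot (Ideal.span {t}) _
        (IsNoetherian.noetherian _) ?_ (((Ideal.span_singleton_le_iff_mem _).2 ht).trans
        (IsLocalRing.maximalIdeal_le_jacobson _))
      intro y hy
      obtain ⟨z, rfl⟩ := Ideal.mem_span_singleton'.1 (hpt hy)
      have hz : z ∈ p := (hp'.mem_or_mem hy).resolve_right (htp p hp)
      rw [mul_comm]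
      exact Submodule.smul_mem_smul (Ideal.mem_span_singleton_self t) hz
    rw [hpbot] at hp'
    exact IsDomain.of_bot_isPrime T

lemma exists_ringKrullDim_eq (T : Type*) [CommRing T] [IsLocalRing T] [IsNoetherianRing T] :
    ∃ n : ℕ, ringKrullDim T = n := by
  have h1 := ringKrullDim_lt_top (R := T)
  have h2 := ringKrullDim_nonneg_of_nontrivial (R := T)
  generalize ringKrullDim T = d at *
  induction d with
  | bot => simp at h2
  | coe d =>
    induction d with
    | top => exact absurd h1 (by simp)
    | coe d => exact ⟨d, rfl⟩

theorem isDomain_of_isRegularLocalRing (T : Type u) [CommRing T] [IsRegularLocalRing T] :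
    IsDomain T :=
  have ⟨n, hn⟩ := exists_ringKrullDim_eq T
  isDomain_of_isRegularLocalRing_of_ringKrullDim_eq n T hn

end Regular

/-! ### `Tor` over regular local rings: vanishing and top degree -/

section TorRegular

open Function

lemma torModule_congr_subsingleton {R : Type u} [CommRing R] {M M' N N' : Type u} [AddCommGroup M]
    [Module R M] [AddCommGroup M']
    [Module R M'] [AddCommGroup N] [Module R N] [AddCommGroup N'] [Module R N']
    (e : M ≃ₗ[R] M') (e' : N ≃ₗ[R] N') (i : ℕ) (h : Subsingleton (torModule R M N i)) :
    Subsingleton (torModule R M' N' i) :=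
  let ⟨ε⟩ := torModule_congr e e' i
  ε.symm.toEquiv.subsingleton

/-- Every finitely generated module over a Noetherian ring has a presentation by a finite free
module with finitely generated kernel. -/
lemma exists_finite_free_presentation (R : Type u) [CommRing R] [IsNoetherianRing R] (M : Type u)
    [AddCommGroup M] [Module R M] [Module.Finite R M] :
    ∃ (n : ℕ) (g : (Fin n → R) →ₗ[R] M), Surjective g ∧ Module.Finite R (LinearMap.ker g) ∧
      Exact (LinearMap.ker g).subtype g :=
  have ⟨n, g, hg⟩ := Module.Finite.exists_fin' R M
  ⟨n, g, hg, inferInstance, LinearMap.exact_subtype_ker_map g⟩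

theorem free_of_subsingleton_torModule_one {T : Type u} [CommRing T] [IsLocalRing T]
    [IsNoetherianRing T] (M : Type u) [AddCommGroup M] [Module T M] [Module.Finite T M]
    (h : Subsingleton (torModule T M (ResidueField T) 1)) : Module.Free T M := by
  obtain ⟨n, g, hg, hfin, hex⟩ := exists_finite_free_presentation T M
  obtain ⟨e⟩ := torModule_one_equiv_ker (Submodule.injective_subtype _) hg hex (ResidueField T)
  have h' : Injective ((LinearMap.ker g).subtype.rTensor (ResidueField T)) := by
    have hsub : Subsingleton (LinearMap.ker ((LinearMap.ker g).subtype.rTensor (ResidueField T))) :=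
      e.symm.toEquiv.subsingleton
    rw [injective_iff_map_eq_zero]
    exact fun z hz ↦ congrArg Subtype.val (Subsingleton.elim (⟨z, hz⟩ : LinearMap.ker _) 0)
  exact Module.free_of_lTensor_residueField_injective _ g hg hex
    ((LinearMap.lTensor_inj_iff_rTensor_inj _ _).2 h')

/-- Vanishing in one degree against the residue field makes the `j`-th syzygy of `M` free. -/
theorem subsingleton_torModule_of_residueField {T : Type u} [CommRing T] [IsLocalRing T]
    [IsNoetherianRing T] (N : Type u) [AddCommGroup N] [Module T N] (j : ℕ) :
    ∀ (M : Type u) [AddCommGroup M] [Module T M] [Module.Finite T M],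
      (Subsingleton (torModule T M (ResidueField T) (j + 1))) →
      ∀ i, j ≤ i → Subsingleton (torModule T M N (i + 1)) := by
  induction j with
  | zero =>
    intro M _ _ _ h i _
    have := free_of_subsingleton_torModule_one M h
    exact subsingleton_torModule_of_flat M N i
  | succ j ih =>
    intro M _ _ _ h i hi
    obtain ⟨i, rfl⟩ : ∃ i', i = i' + 1 := ⟨i - 1, by omega⟩
    obtain ⟨n, g, hg, hfin, hex⟩ := exists_finite_free_presentation T M
    obtain ⟨e⟩ := torModule_shift (Submodule.injective_subtype _) hg hex (ResidueField T) j
    obtain ⟨e'⟩ := torModule_shift (Submodule.injective_subtype _) hg hex N i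
    have := ih (LinearMap.ker g) e.symm.toEquiv.subsingleton i (by omega)
    exact e'.toEquiv.subsingleton

lemma isSMulRegular_of_isDomain {T : Type*} [CommRing T] [IsDomain T] {t : T} (ht : t ≠ 0) :
    IsSMulRegular T t := fun _ _ h ↦ mul_left_cancel₀ ht h

lemma isSMulRegular_pi {T : Type*} [CommRing T] {t : T} (ht : IsSMulRegular T t) (n : ℕ) :
    IsSMulRegular (Fin n → T) t := fun a b h ↦ by
  ext j
  exact ht (congrFun h j)

lemma surjective_and_ker_quotient {T : Type*} [CommRing T] (t : T) :
    Surjective (algebraMap T (T ⧸ Ideal.span {t})) ∧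
      RingHom.ker (algebraMap T (T ⧸ Ideal.span {t})) = Ideal.span {t} :=
  ⟨Ideal.Quotient.mk_surjective, Ideal.mk_ker⟩

/-- Induction on the dimension: after one syzygy the first module is torsion-free, so a parameter
`t` outside the square of the maximal ideal is regular on it, and `Tor` can be computed over
`T/(t)`, which is regular of smaller dimension. The shift costs exactly one degree. -/
lemma subsingleton_torModule_of_simple (n : ℕ) : ∀ (T : Type u) [CommRing T] [IsRegularLocalRing T],
    ringKrullDim T = n → ∀ (M N : Type u) [AddCommGroup M] [Module T M] [Module.Finite T M]
    [AddCommGroup N] [Module T N], (∀ t ∈ maximalIdeal T, ∀ y : N, t • y = 0) → ∀ i, n ≤ i →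
    Subsingleton (torModule T M N (i + 1)) := by
  induction n with
  | zero =>
    intro T _ _ hn M N _ _ _ _ _ _ i _
    have h := IsRegularLocalRing.spanFinrank_maximalIdeal (R := T)
    rw [hn] at h
    have hbot : maximalIdeal T = ⊥ :=
      (Submodule.spanFinrank_eq_zero_iff_eq_bot (IsNoetherian.noetherian _)).1 (by exact_mod_cast h)
    let := (IsLocalRing.isField_iff_maximalIdeal_eq.2 hbot).toField
    have : Module.Free T M := Module.Free.of_divisionRing T M
    exact subsingleton_torModule_of_flat M N i
  | succ n ih =>
    intro T _ _ hn M N _ _ _ _ _ hN i hi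
    have := isDomain_of_isRegularLocalRing T
    obtain ⟨t, ht, ht2, -⟩ := exists_mem_maximalIdeal_notMem_sq (T := T) (by
      rw [hn]; exact_mod_cast Nat.succ_pos n)
    obtain ⟨hreg, hdim⟩ := isRegularLocalRing_quotient hn ht ht2
    obtain ⟨m, g, hg, hfin, hex⟩ := exists_finite_free_presentation T M
    obtain ⟨i, rfl⟩ : ∃ i', i = i' + 1 := ⟨i - 1, by omega⟩
    have ht0 : IsSMulRegular T t := isSMulRegular_of_isDomain fun h ↦ ht2 (h ▸ zero_mem _)
    have htor : Module.IsTorsionBySet T N (Ideal.span {t} : Set T) := fun y a ↦ by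
      obtain ⟨b, hb⟩ := Ideal.mem_span_singleton'.1 a.2
      rw [← hb, mul_smul, hN t ht, smul_zero]
    let := htor.module
    have : IsScalarTower T (T ⧸ Ideal.span {t}) N := htor.isScalarTower
    obtain ⟨ε, -⟩ := torModule_addEquiv_of_isSMulRegular (L := LinearMap.ker g)
      (surjective_and_ker_quotient t).1 (surjective_and_ker_quotient t).2 ht0
      ((isSMulRegular_pi ht0 m).submodule _ t) N i
    obtain ⟨e⟩ := torModule_shift (Submodule.injective_subtype _) hg hex N i
    have := ih (T ⧸ Ideal.span {t}) hdim ((T ⧸ Ideal.span {t}) ⊗[T] LinearMap.ker g) N (by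
      intro s hs y
      obtain ⟨s, rfl⟩ := Ideal.Quotient.mk_surjective s
      change algebraMap T (T ⧸ Ideal.span {t}) s • y = 0
      rw [algebraMap_smul]
      refine hN s ?_ y
      rw [mem_maximalIdeal, mem_nonunits_iff] at hs ⊢
      exact fun h ↦ hs (h.map _)) i (by omega)
    have := ε.symm.toEquiv.subsingleton
    exact e.toEquiv.subsingleton

/-- `Tor` over a regular local ring vanishes above the dimension. -/
theorem subsingleton_torModule_of_isRegularLocalRing {T : Type u} [CommRing T]
    [IsRegularLocalRing T] {n : ℕ} (hn : ringKrullDim T = n)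
    (M N : Type u) [AddCommGroup M] [Module T M] [Module.Finite T M]
    [AddCommGroup N] [Module T N] (i : ℕ) (hi : n ≤ i) :
    Subsingleton (torModule T M N (i + 1)) := by
  refine subsingleton_torModule_of_residueField N n M ?_ i hi
  refine subsingleton_torModule_of_simple n T hn M (ResidueField T) (fun t ht y ↦ ?_) n le_rfl
  obtain ⟨y, rfl⟩ := residue_surjective y
  rw [Algebra.smul_def, ResidueField.algebraMap_eq, ← map_mul, residue_eq_zero_iff]
  exact Ideal.mul_mem_right _ _ ht

lemma nonempty_equiv_residueField {T : Type u} [CommRing T] [IsLocalRing T] (N : Type u)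
    [AddCommGroup N] [Module T N] [IsSimpleModule T N] : Nonempty (N ≃ₗ[T] ResidueField T) := by
  obtain ⟨I, hI, ⟨e⟩⟩ := isSimpleModule_iff_quot_maximal.1 ‹IsSimpleModule T N›
  obtain rfl := IsLocalRing.eq_maximalIdeal hI
  exact ⟨e⟩

lemma smul_eq_zero_of_isSimpleModule {T : Type u} [CommRing T] [IsLocalRing T] {N : Type u}
    [AddCommGroup N] [Module T N] [IsSimpleModule T N] {t : T} (ht : t ∈ maximalIdeal T) (y : N) :
    t • y = 0 := by
  obtain ⟨e⟩ := nonempty_equiv_residueField (T := T) N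
  apply e.injective
  rw [map_smul, map_zero]
  obtain ⟨z, hz⟩ := residue_surjective (e y)
  rw [← hz, Algebra.smul_def, ResidueField.algebraMap_eq, ← map_mul, residue_eq_zero_iff]
  exact Ideal.mul_mem_right _ _ ht

/-- In the change of rings sequence for `T/(t)`, the top `Tor` over `T/(t)` sits between a `Tor`
over `T/(t)` above its dimension, which is zero, and the top `Tor` over `T`. Vanishing of the latter
would thus descend to dimension one, where it makes a nonzero module killed by the maximal ideal
free. -/
lemma not_subsingleton_torModule_of_simple (n : ℕ) : ∀ (T : Type u) [CommRing T]
    [IsRegularLocalRing T], ringKrullDim T = (n + 1 : ℕ) → ∀ (M N : Type u) [AddCommGroup M]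
    [Module T M] [AddCommGroup N] [Module T N] [IsSimpleModule T M] [IsSimpleModule T N],
    ¬ Subsingleton (torModule T M N (n + 1)) := by
  induction n with
  | zero =>
    intro T _ _ hn M N _ _ _ _ _ _ h
    obtain ⟨e⟩ := nonempty_equiv_residueField (T := T) N
    have h1 := torModule_congr_subsingleton (LinearEquiv.refl T M) e 1 h
    have : Module.Free T M := free_of_subsingleton_torModule_one M h1
    have hbot : maximalIdeal T = ⊥ := by
      rw [eq_bot_iff]
      intro t ht
      have : Nontrivial M := IsSimpleModule.nontrivial T M
      rw [Submodule.mem_bot]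
      exact FaithfulSMul.eq_of_smul_eq_smul fun y : M ↦ by
        rw [smul_eq_zero_of_isSimpleModule ht, zero_smul]
    have hf := IsLocalRing.isField_iff_maximalIdeal_eq.2 hbot
    rw [ringKrullDim_eq_zero_of_isField hf] at hn
    exact absurd hn (by norm_cast)
  | succ n ih =>
    intro T _ _ hn M N _ _ _ _ _ _ h
    have := isDomain_of_isRegularLocalRing T
    obtain ⟨t, ht, ht2, -⟩ := exists_mem_maximalIdeal_notMem_sq (T := T) (by
      rw [hn]; exact_mod_cast Nat.succ_pos _)
    obtain ⟨hreg, hdim⟩ := isRegularLocalRing_quotient hn ht ht2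
    have ht0 : IsSMulRegular T t := isSMulRegular_of_isDomain fun h ↦ ht2 (h ▸ zero_mem _)
    have htor (X : Type u) [AddCommGroup X] [Module T X] [IsSimpleModule T X] :
        Module.IsTorsionBySet T X (Ideal.span {t} : Set T) := fun y a ↦ by
      obtain ⟨b, hb⟩ := Ideal.mem_span_singleton'.1 a.2
      rw [← hb, mul_smul, smul_eq_zero_of_isSimpleModule ht, smul_zero]
    let := (htor M).module
    let := (htor N).module
    have : IsScalarTower T (T ⧸ Ideal.span {t}) M := (htor M).isScalarTower
    have : IsScalarTower T (T ⧸ Ideal.span {t}) N := (htor N).isScalarTower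
    have hs := (surjective_and_ker_quotient t).1
    have : IsSimpleModule (T ⧸ Ideal.span {t}) M :=
      (isSimpleModule_iff_isSimpleModule_of_algebraMap_surjective hs).1 ‹_›
    have : IsSimpleModule (T ⧸ Ideal.span {t}) N :=
      (isSimpleModule_iff_isSimpleModule_of_algebraMap_surjective hs).1 ‹_›
    obtain ⟨X, ε, α, β, δ, -, -, -, hδ⟩ := exists_changeOfRings_exact hs
      (surjective_and_ker_quotient t).2 ht0 M N
    have h1 : Subsingleton (torModule (T ⧸ Ideal.span {t}) M N (n + 3)) :=
      subsingleton_torModule_of_isRegularLocalRing hdim M N (n + 2) (by omega)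
    have h2 : Subsingleton (X n) := (ε n).toEquiv.subsingleton
    refine ih (T ⧸ Ideal.span {t}) hdim M N ⟨fun a b ↦ ?_⟩
    rw [← sub_eq_zero]
    obtain ⟨z, hz⟩ := (hδ n (a - b)).1 (Subsingleton.elim _ _)
    rw [← hz, Subsingleton.elim z 0, map_zero]

/-- A finitely generated module whose top `Tor` against the residue field vanishes has no socle. -/
theorem eq_zero_of_subsingleton_torModule {T : Type u} [CommRing T] [IsRegularLocalRing T] {n : ℕ}
    (hn : ringKrullDim T = (n + 1 : ℕ)) (X : Type u) [AddCommGroup X] [Module T X]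
    [Module.Finite T X] (h : Subsingleton (torModule T X (ResidueField T) (n + 1))) (z : X)
    (hz : ∀ t ∈ maximalIdeal T, t • z = 0) : z = 0 := by
  by_contra hz0
  have hsimple : IsSimpleModule T (Submodule.span T {z}) := by
    rw [isSimpleModule_iff_toSpanSingleton_surjective]
    refine ⟨Submodule.nontrivial_span_singleton hz0, ?_⟩
    rintro ⟨y, hy⟩ hy0 ⟨w, hw⟩
    obtain ⟨c, rfl⟩ := Submodule.mem_span_singleton.1 hy
    obtain ⟨d, rfl⟩ := Submodule.mem_span_singleton.1 hw
    have hc : IsUnit c := by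
      by_contra hc
      exact hy0 (Subtype.ext (hz c hc))
    obtain ⟨c', hc'⟩ := hc.exists_left_inv
    exact ⟨d * c', Subtype.ext (by simp [smul_smul, mul_assoc, hc'])⟩
  have : IsSimpleModule T (ResidueField T) :=
    isSimpleModule_iff_quot_maximal.2 ⟨maximalIdeal T, inferInstance, ⟨LinearEquiv.refl T _⟩⟩
  -- A socle element spans a copy of the residue field. Its top `Tor` injects into that of `X`,
  -- because `Tor` of the quotient vanishes one degree higher.
  obtain ⟨α, β, δ, -, -, -, -, h₃, -⟩ := exists_tor_long_exact (R := T)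
    (Submodule.injective_subtype (Submodule.span T {z})) (Submodule.mkQ_surjective _)
    (LinearMap.exact_subtype_mkQ _) (ResidueField T)
  have h1 := subsingleton_torModule_of_isRegularLocalRing hn (X ⧸ Submodule.span T {z})
    (ResidueField T) (n + 1) le_rfl
  refine not_subsingleton_torModule_of_simple n T hn (Submodule.span T {z}) (ResidueField T)
    ⟨fun a b ↦ ?_⟩
  rw [← sub_eq_zero]
  obtain ⟨z, hz⟩ := (h₃ (n + 1) (a - b)).1 (Subsingleton.elim _ _)
  rw [← hz, Subsingleton.elim z 0, map_zero]

end TorRegular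

/-! ### Modules supported at the closed point -/

section FiniteLength

open Function

variable {R : Type u} [CommRing R] [IsLocalRing R] [IsNoetherianRing R]
  {X : Type u} [AddCommGroup X] [Module R X] [Module.Finite R X]

theorem exists_pow_le_annihilator
    (h : ∀ p : PrimeSpectrum R, p.asIdeal ≠ maximalIdeal R → p ∉ Module.support R X) :
    ∃ k, maximalIdeal R ^ k ≤ Module.annihilator R X := by
  apply Ideal.exists_pow_le_of_le_radical_of_fg _ (IsNoetherian.noetherian _)
  rw [Ideal.radical_eq_sInf]
  refine le_sInf fun p ⟨hp, hpp⟩ ↦ ?_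
  by_contra hle
  exact h ⟨p, hpp⟩ (fun h ↦ hle h.ge) (Module.mem_support_iff_of_finite.2 hp)

theorem isFiniteLength_of_support
    (h : ∀ p : PrimeSpectrum R, p.asIdeal ≠ maximalIdeal R → p ∉ Module.support R X) :
    IsFiniteLength R X := by
  let I := Module.annihilator R X
  have : Ring.KrullDimLE 0 (R ⧸ I) := by
    rw [Ring.krullDimLE_zero_iff]
    intro P hP
    have hP' : (P.comap (Ideal.Quotient.mk I)).IsPrime := inferInstance
    have hI : I ≤ P.comap (Ideal.Quotient.mk I) :=
      Ideal.mk_ker.ge.trans (Ideal.ker_le_comap _)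
    have heq : P.comap (Ideal.Quotient.mk I) = maximalIdeal R := by
      by_contra hne
      exact h ⟨_, hP'⟩ hne (Module.mem_support_iff_of_finite.2 hI)
    have := maximalIdeal.isMaximal R
    rw [← heq] at this
    rw [← Ideal.map_comap_of_surjective _ Ideal.Quotient.mk_surjective P]
    refine (Ideal.map_eq_top_or_isMaximal_of_surjective _ Ideal.Quotient.mk_surjective
      this).resolve_left ?_
    rw [Ideal.map_comap_of_surjective _ Ideal.Quotient.mk_surjective]
    exact hP.ne_top
  have hart : IsArtinianRing (R ⧸ I) := IsNoetherianRing.isArtinianRing_of_krullDimLE_zero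
  let : Module (R ⧸ I) X := Module.quotientAnnihilator
  have : IsScalarTower R (R ⧸ I) X := ⟨fun r s x ↦ by
    obtain ⟨s, rfl⟩ := Ideal.Quotient.mk_surjective s
    exact mul_smul r s x⟩
  have : Module.Finite (R ⧸ I) X := Module.Finite.of_restrictScalars_finite R _ _
  have : IsArtinian (R ⧸ I) X := inferInstance
  have : IsArtinian R X := isArtinian_of_surjective_algebraMap
    (R := R ⧸ I) Ideal.Quotient.mk_surjective
  have : IsNoetherian R X := isNoetherian_of_isNoetherianRing_of_finite R X
  exact isFiniteLength_iff_isNoetherian_isArtinian.2 ⟨inferInstance, inferInstance⟩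

theorem isAdicComplete_of_pow_le_annihilator {k : ℕ}
    (hk : maximalIdeal R ^ k ≤ Module.annihilator R X) : IsAdicComplete (maximalIdeal R) X := by
  have hbot (n : ℕ) (hn : k ≤ n) : maximalIdeal R ^ n • (⊤ : Submodule R X) = ⊥ := by
    rw [eq_bot_iff, Submodule.smul_le]
    intro r hr x _
    exact Module.mem_annihilator.1 (hk (Ideal.pow_le_pow_right hn hr)) x
  have : IsPrecomplete (maximalIdeal R) X := ⟨fun f hf ↦ ⟨f k, fun n ↦ ?_⟩⟩
  · exact {}
  · rcases le_total n k with h | h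
    · exact hf h
    · have := hf h
      rw [hbot k le_rfl, SModEq.bot] at this
      rw [this]

/-- A module killed by a power of the maximal ideal is its own completion. This lets isomorphisms of
`Tor` modules over the completion descend to `R`. -/
theorem nonempty_completion_tensor_equiv {k : ℕ}
    (hk : maximalIdeal R ^ k ≤ Module.annihilator R X) :
    Nonempty (AdicCompletion (maximalIdeal R) R ⊗[R] X ≃ₗ[R] X) := by
  have := isAdicComplete_of_pow_le_annihilator hk
  exact ⟨(AdicCompletion.ofTensorProductEquivOfFiniteNoetherian
    (maximalIdeal R) X).restrictScalars R
    ≪≫ₗ (AdicCompletion.ofLinearEquiv (maximalIdeal R) X).symm⟩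

end FiniteLength

/-! ### Finite length and two-periodicity over hypersurfaces -/

section Periodic

open Function

theorem notMem_support_torModule {R : Type u} [CommRing R] [IsNoetherianRing R]
    (M N : Type u) [AddCommGroup M] [Module R M] [Module.Finite R M]
    [AddCommGroup N] [Module R N] {d : ℕ} (hd : ringKrullDim R ≤ d) (p : PrimeSpectrum R)
    (hp : p ∉ singularLocus R) (i : ℕ) (hi : d ≤ i) :
    p ∉ Module.support R (torModule R M N (i + 1)) := by
  have hreg : IsRegularLocalRing (Localization.AtPrime p.asIdeal) := not_not.1 hp
  have hdim : ringKrullDim (Localization.AtPrime p.asIdeal) ≤ d := by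
    rw [IsLocalization.AtPrime.ringKrullDim_eq_height p.asIdeal]
    exact (Ideal.height_le_ringKrullDim_of_isPrime).trans hd
  obtain ⟨n, hn⟩ := exists_ringKrullDim_eq (Localization.AtPrime p.asIdeal)
  obtain ⟨e⟩ := torModule_flat_baseChange (A := R) (Localization.AtPrime p.asIdeal) i M N
  have h := subsingleton_torModule_of_isRegularLocalRing hn
    (Localization.AtPrime p.asIdeal ⊗[R] M) (Localization.AtPrime p.asIdeal ⊗[R] N) i (by
      rw [hn] at hdim; exact (by exact_mod_cast hdim : n ≤ d).trans hi)
  rw [Module.notMem_support_iff]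
  have h2 : Subsingleton (Localization.AtPrime p.asIdeal ⊗[R] torModule R M N (i + 1)) :=
    e.symm.toEquiv.subsingleton
  exact (LocalizedModule.equivTensorProduct p.asIdeal.primeCompl _).toEquiv.subsingleton

/-- For `f ≠ 0` the connecting map `δ i` lies between `Tor` modules over `T` above its dimension, so
it is bijective. For `f = 0` the ring `S` is regular of dimension `n` and both sides vanish, which
costs one more degree; hence `hi₀`. -/
theorem torModule_periodic {T S : Type u} [CommRing T] [IsRegularLocalRing T] [CommRing S]
    [Algebra T S] {f : T} (hs : Surjective (algebraMap T S))
    (hk : RingHom.ker (algebraMap T S) = Ideal.span {f}) {n : ℕ} (hn : ringKrullDim T = n)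
    (M N : Type u) [AddCommGroup M] [Module S M] [Module.Finite S M] [AddCommGroup N] [Module S N]
    (i : ℕ) (hi : n ≤ i + 1) (hi₀ : f = 0 → n ≤ i) :
    Nonempty (torModule S M N (i + 3) ≃ₗ[S] torModule S M N (i + 1)) := by
  have := isDomain_of_isRegularLocalRing T
  by_cases hf : f = 0
  · have hinj : Injective (algebraMap T S) := by
      rw [RingHom.injective_iff_ker_eq_bot, hk, hf, Ideal.span_singleton_zero]
    let e : T ≃+* S := RingEquiv.ofBijective _ ⟨hinj, hs⟩
    have := IsRegularLocalRing.of_ringEquiv e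
    have hS : ringKrullDim S = n := by rw [← ringKrullDim_eq_of_ringEquiv e, hn]
    have h1 := subsingleton_torModule_of_isRegularLocalRing hS M N i (hi₀ hf)
    have h2 := subsingleton_torModule_of_isRegularLocalRing hS M N (i + 2) (by omega)
    exact ⟨0⟩
  · let : Module T M := Module.compHom M (algebraMap T S)
    let : Module T N := Module.compHom N (algebraMap T S)
    have : IsScalarTower T S M := IsScalarTower.of_algebraMap_smul fun _ _ ↦ rfl
    have : IsScalarTower T S N := IsScalarTower.of_algebraMap_smul fun _ _ ↦ rfl
    have : Module.Finite T S := Module.Finite.of_surjective (Algebra.linearMap T S) hs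
    have : Module.Finite T M := Module.Finite.trans S M
    obtain ⟨X, ε, α, β, δ, -, -, h2, h3⟩ :=
      exists_changeOfRings_exact hs hk (isSMulRegular_of_isDomain hf) M N
    have hT (j : ℕ) (hj : i ≤ j) : Subsingleton (X j) := by
      have := subsingleton_torModule_of_isRegularLocalRing hn M N (j + 1) (by omega)
      exact (ε j).toEquiv.subsingleton
    have s1 := hT i le_rfl
    have s2 := hT (i + 1) (by omega)
    refine ⟨LinearEquiv.ofBijective (δ i) ⟨?_, fun y ↦ (h3 i y).1 (Subsingleton.elim _ _)⟩⟩
    rw [injective_iff_map_eq_zero]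
    intro y hy
    obtain ⟨z, rfl⟩ := (h2 i y).1 hy
    rw [Subsingleton.elim z 0, map_zero]

theorem exists_regular_presentation {R : Type u} [CommRing R] (hR : IsHypersurface R) :
    ∃ (T : Type u) (_ : CommRing T) (_ : IsRegularLocalRing T) (f : T)
      (_ : Algebra T (AdicCompletion (maximalIdeal R) R)), f ∈ maximalIdeal T ∧
      Surjective (algebraMap T (AdicCompletion (maximalIdeal R) R)) ∧
      RingHom.ker (algebraMap T (AdicCompletion (maximalIdeal R) R)) = Ideal.span {f} := by
  obtain ⟨T, iT, iT', f, hf, ⟨e⟩⟩ := hR.completion_eq_quotient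
  let φ : T →+* AdicCompletion (maximalIdeal R) R :=
    e.symm.toRingHom.comp (Ideal.Quotient.mk (Ideal.span {f}))
  refine ⟨T, iT, iT', f, φ.toAlgebra, hf, ?_, ?_⟩
  · exact e.symm.surjective.comp Ideal.Quotient.mk_surjective
  · change RingHom.ker φ = _
    ext t
    rw [RingHom.mem_ker]
    change e.symm _ = 0 ↔ _
    rw [EmbeddingLike.map_eq_zero_iff, Ideal.Quotient.eq_zero_iff_mem]

theorem isNoetherianRing_completion {R : Type u} [CommRing R] (hR : IsHypersurface R) :
    IsNoetherianRing (AdicCompletion (maximalIdeal R) R) := by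
  obtain ⟨T, iT, iT', f, a, -, hs, -⟩ := exists_regular_presentation hR
  exact isNoetherianRing_of_surjective _ _ _ hs

/-- By flatness going down holds, so heights add; the closed fibre contributes zero, as the maximal
ideal of the completion is extended from `R`. -/
theorem ringKrullDim_completion {R : Type u} [CommRing R] [IsLocalRing R] [IsNoetherianRing R]
    [IsNoetherianRing (AdicCompletion (maximalIdeal R) R)] :
    ringKrullDim (AdicCompletion (maximalIdeal R) R) = ringKrullDim R := by
  rw [← maximalIdeal_height_eq_ringKrullDim, ← maximalIdeal_height_eq_ringKrullDim]
  have hl : (maximalIdeal (AdicCompletion (maximalIdeal R) R)).LiesOver (maximalIdeal R) :=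
    ⟨(IsLocalRing.maximalIdeal_comap _).symm⟩
  have hmap := AdicCompletion.maximalIdeal_eq_map (R := R)
  have hne : (maximalIdeal R).map (algebraMap R (AdicCompletion (maximalIdeal R) R)) ≠ ⊤ := by
    rw [← hmap]; exact (maximalIdeal.isMaximal _).ne_top
  have : Nontrivial (AdicCompletion (maximalIdeal R) R ⧸
    (maximalIdeal R).map (algebraMap R (AdicCompletion (maximalIdeal R) R))) :=
    Ideal.Quotient.nontrivial_iff.2 hne
  rw [Ideal.height_eq_height_add_of_liesOver_of_hasGoingDown (maximalIdeal R)
    (maximalIdeal (AdicCompletion (maximalIdeal R) R)), hmap, Ideal.map_quotient_self,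
    Ideal.height_bot, add_zero]

/-- In terms of a presentation `T / (f)` of the completion, the dimension. -/
theorem ringKrullDim_presentation {R : Type u} [CommRing R] (hR : IsHypersurface R) {T : Type u}
    [CommRing T] [IsRegularLocalRing T] {f : T} [Algebra T (AdicCompletion (maximalIdeal R) R)]
    (hf : f ∈ maximalIdeal T) (hs : Surjective (algebraMap T (AdicCompletion (maximalIdeal R) R)))
    (hk : RingHom.ker (algebraMap T (AdicCompletion (maximalIdeal R) R)) = Ideal.span {f})
    {d : ℕ} (hd : ringKrullDim R = d) :
    (f = 0 → ringKrullDim T = d) ∧ (f ≠ 0 → ringKrullDim T = (d + 1 : ℕ)) := by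
  have := isNoetherianRing_completion hR
  have := isDomain_of_isRegularLocalRing T
  have e : (T ⧸ Ideal.span {f}) ≃+* AdicCompletion (maximalIdeal R) R :=
    (Ideal.quotEquivOfEq hk.symm).trans (RingHom.quotientKerEquivOfSurjective hs)
  have hd' := hd
  rw [← ringKrullDim_completion, ← ringKrullDim_eq_of_ringEquiv e] at hd'
  constructor
  · rintro rfl
    rw [← hd', Ideal.span_singleton_zero]
    exact (ringKrullDim_eq_of_ringEquiv (RingEquiv.quotientBot T)).symm
  · intro hf0
    rw [← ringKrullDim_quotient_span_singleton_succ_eq_ringKrullDim_of_mem_nonZeroDivisors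
      (mem_nonZeroDivisors_of_ne_zero hf0) hf, hd']
    simp

theorem support_torModule_of_isHypersurface {R : Type u} [CommRing R] [IsLocalRing R]
    [IsNoetherianRing R] (hsing : HasIsolatedSingularity R) {d : ℕ} (hd : ringKrullDim R = d)
    (M N : Type u) [AddCommGroup M] [Module R M] [Module.Finite R M]
    [AddCommGroup N] [Module R N] (i : ℕ) (hi : d ≤ i) (p : PrimeSpectrum R)
    (hp : p.asIdeal ≠ maximalIdeal R) :
    p ∉ Module.support R (torModule R M N (i + 1)) :=
  notMem_support_torModule M N hd.le p
    (fun h ↦ hp (IsLocalRing.eq_maximalIdeal (hsing p h))) i hi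

theorem torModule_of_isHypersurface {R : Type u} [CommRing R] (hR : IsHypersurface R)
    (hsing : HasIsolatedSingularity R) {d : ℕ} (hd : ringKrullDim R = d)
    (M N : Type u) [AddCommGroup M] [Module R M] [Module.Finite R M]
    [AddCommGroup N] [Module R N] [Module.Finite R N] (i : ℕ) (hi : d ≤ i) :
    IsFiniteLength R (torModule R M N (i + 1)) ∧
      Nonempty (torModule R M N (i + 3) ≃ₗ[R] torModule R M N (i + 1)) := by
  have h1 := support_torModule_of_isHypersurface hsing hd M N i hi
  have h3 := support_torModule_of_isHypersurface hsing hd M N (i + 2) (by omega)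
  have f1 := finite_torModule (R := R) (i + 1) M N
  have f3 := finite_torModule (R := R) (i + 3) M N
  refine ⟨isFiniteLength_of_support h1, ?_⟩
  obtain ⟨k1, hk1⟩ := exists_pow_le_annihilator h1
  obtain ⟨k3, hk3⟩ := exists_pow_le_annihilator h3
  obtain ⟨e1⟩ := nonempty_completion_tensor_equiv hk1
  obtain ⟨e3⟩ := nonempty_completion_tensor_equiv hk3
  obtain ⟨t1⟩ := torModule_flat_baseChange (A := R) (AdicCompletion (maximalIdeal R) R) i M N
  obtain ⟨t3⟩ := torModule_flat_baseChange (A := R) (AdicCompletion (maximalIdeal R) R) (i + 2) M N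
  obtain ⟨T, iT, iT', f, a, hf, hs, hk⟩ := exists_regular_presentation hR
  obtain ⟨hd0, hd1⟩ := ringKrullDim_presentation hR hf hs hk hd
  have : ∃ n : ℕ, ringKrullDim T = n ∧ n ≤ i + 1 ∧ (f = 0 → n ≤ i) := by
    by_cases hf0 : f = 0
    · exact ⟨d, hd0 hf0, by omega, fun _ ↦ hi⟩
    · exact ⟨d + 1, hd1 hf0, by omega, fun h ↦ absurd h hf0⟩
  obtain ⟨n, hn, hn1, hn2⟩ := this
  obtain ⟨e⟩ := torModule_periodic hs hk hn (AdicCompletion (maximalIdeal R) R ⊗[R] M)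
    (AdicCompletion (maximalIdeal R) R ⊗[R] N) i hn1 hn2
  exact ⟨e3.symm ≪≫ₗ (t3.symm ≪≫ₗ e ≪≫ₗ t1).restrictScalars R ≪≫ₗ e1⟩

end Periodic

/-! ### Depth two and the punctured spectrum -/

section Depth

open Function

lemma mem_of_pow_mul_mem {R : Type*} [CommRing R] {m J : Ideal R}
    (h : ∀ z, (∀ r ∈ m, r * z ∈ J) → z ∈ J) (k : ℕ) :
    ∀ z, (∀ r ∈ m ^ k, r * z ∈ J) → z ∈ J := by
  induction k with
  | zero => intro z hz; simpa using hz 1 (by simp)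
  | succ k ih =>
    intro z hz
    refine ih z fun r hr ↦ h _ fun s hs ↦ ?_
    rw [← mul_assoc, mul_comm s r]
    exact hz _ (by rw [pow_succ]; exact Ideal.mul_mem_mul hr hs)

/-- If the maximal ideal consists of zero divisors, prime avoidance puts it inside an associated
prime, the annihilator of some `z`, and then `z` is a socle element. -/
lemma exists_mem_nonZeroDivisors {R : Type*} [CommRing R] [IsLocalRing R] [IsNoetherianRing R]
    (h : ∀ z : R, (∀ r ∈ maximalIdeal R, r * z = 0) → z = 0) :
    ∃ a ∈ maximalIdeal R, a ∈ nonZeroDivisors R := by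
  by_contra! hcon
  have hfin := associatedPrimes.finite R R
  have hsub : (maximalIdeal R : Set R) ⊆
      ⋃ p ∈ (hfin.toFinset : Set (Ideal R)), (id p : Ideal R) := by
    intro a ha
    have : a ∈ ⋃ p ∈ associatedPrimes R R, (p : Set R) := by
      rw [biUnion_associatedPrimes_eq_compl_nonZeroDivisors]
      exact hcon a ha
    simpa using this
  obtain ⟨p, hp, hle⟩ := (Ideal.subset_union_prime (s := hfin.toFinset) (f := id) ⊥ ⊥
    fun p hp _ _ ↦ by
      have : p ∈ associatedPrimes R R := by simpa using hp
      exact this.isPrime).1 hsub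
  have hp' : p ∈ associatedPrimes R R := by simpa using hp
  rw [AssociatedPrimes.mem_iff, isAssociatedPrime_iff] at hp'
  obtain ⟨hprime, z, rfl⟩ := hp'
  have hz : z = 0 := h z fun r hr ↦ by
    simpa using hle hr
  subst hz
  exact hprime.ne_top (by ext; simp)

/-- A local ring of depth at least two which is a domain on the punctured spectrum is a domain. -/
theorem mem_nonZeroDivisors_of_punctured {R : Type u} [CommRing R] [IsLocalRing R]
    [IsNoetherianRing R]
    (h0 : ∀ z : R, (∀ r ∈ maximalIdeal R, r * z = 0) → z = 0)
    (h1 : ∀ a ∈ nonZeroDivisors R, a ∈ maximalIdeal R →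
      ∀ z : R, (∀ r ∈ maximalIdeal R, r * z ∈ Ideal.span {a}) → z ∈ Ideal.span {a})
    (hdom : ∀ (p : Ideal R) [p.IsPrime], p ≠ maximalIdeal R → IsDomain (Localization.AtPrime p))
    {x : R} (hx : x ≠ 0) : x ∈ nonZeroDivisors R := by
  by_contra hxn
  have hxn' : ∃ y, y ≠ 0 ∧ y * x = 0 := by
    by_contra! hcon
    exact hxn (mem_nonZeroDivisors_iff_right.2 fun y hy ↦ by
      by_contra hy0
      exact hcon y hy0 hy)
  obtain ⟨y, hy0, hyx⟩ := hxn'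
  let I : Ideal R := Submodule.annihilator (Ideal.span {x})
  have hI (r : R) : r ∈ I ↔ r * x = 0 := Submodule.mem_annihilator_span_singleton x r
  let J : Ideal R := Submodule.annihilator I
  have hIJ (i j : R) (hi : i ∈ I) (hj : j ∈ J) : j * i = 0 := Submodule.mem_annihilator.1 hj i hi
  have hxJ : x ∈ J := Submodule.mem_annihilator.2 fun i hi ↦ by
    rw [smul_eq_mul, mul_comm]; exact (hI i).1 hi
  -- At a non-maximal prime containing `I`, the image of `x` in the domain `R_p` is nonzero, so `I`
  -- localizes to zero and `J` is not contained in `p`.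
  have hrad : ∃ k, maximalIdeal R ^ k ≤ I ⊔ J := by
    apply Ideal.exists_pow_le_of_le_radical_of_fg _ (IsNoetherian.noetherian _)
    rw [Ideal.radical_eq_sInf]
    refine le_sInf fun p ⟨hp, hpp⟩ ↦ ?_
    by_contra hle
    have := hdom p fun h ↦ hle h.ge
    have hxp : algebraMap R (Localization.AtPrime p) x ≠ 0 := by
      intro h
      obtain ⟨s, hs⟩ := (IsLocalization.map_eq_zero_iff p.primeCompl _ x).1 h
      exact s.2 (hp (Ideal.mem_sup_left ((hI s).2 hs)))
    have hsupp : (⟨p, hpp⟩ : PrimeSpectrum R) ∈ Module.support R I :=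
      Module.mem_support_iff_of_finite.2 (le_sup_right.trans hp)
    obtain ⟨i, hi⟩ := Module.mem_support_iff_exists_annihilator.1 hsupp
    have hip : algebraMap R (Localization.AtPrime p) i = 0 := by
      have : algebraMap R (Localization.AtPrime p) i * algebraMap R _ x = 0 := by
        rw [← map_mul, (hI i).1 i.2, map_zero]
      exact (mul_eq_zero.1 this).resolve_right hxp
    obtain ⟨s, hs⟩ := (IsLocalization.map_eq_zero_iff p.primeCompl _ (i : R)).1 hip
    exact s.2 (hi ((Submodule.mem_annihilator_span_singleton i _).2 (Subtype.ext hs)))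
  obtain ⟨k, hk⟩ := hrad
  obtain ⟨a₀, ha₀, ha₀'⟩ := exists_mem_nonZeroDivisors h0
  -- The exponent `k + 1` rather than `k` keeps the power in the maximal ideal when `k = 0`.
  have ha : a₀ ^ (k + 1) ∈ nonZeroDivisors R := pow_mem ha₀' _
  have hak : a₀ ^ (k + 1) ∈ maximalIdeal R ^ k :=
    Ideal.pow_le_pow_right (Nat.le_succ k) (Ideal.pow_mem_pow ha₀ _)
  have ham : a₀ ^ (k + 1) ∈ maximalIdeal R :=
    Ideal.pow_le_self k.succ_ne_zero (Ideal.pow_mem_pow ha₀ _)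
  generalize a₀ ^ (k + 1) = a at ha hak ham
  obtain ⟨i, hi, j, hj, hij⟩ := Submodule.mem_sup.1 (hk hak)
  -- For `b = i' + j'` in the `k`-th power, `I J = 0` gives `b i = i i' = i' a`, so depth two forces
  -- `i` into `(a)`.
  have hia : i ∈ Ideal.span {a} := by
    refine mem_of_pow_mul_mem (h1 a ha ham) k i fun b hb ↦ ?_
    obtain ⟨i', hi', j', hj', rfl⟩ := Submodule.mem_sup.1 (hk hb)
    refine Ideal.mem_span_singleton'.2 ⟨i', ?_⟩
    have e1 := hIJ i' j hi' hj
    have e2 := hIJ i j' hi hj'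
    rw [← hij]
    linear_combination e1 - e2
  obtain ⟨c, rfl⟩ := Ideal.mem_span_singleton'.1 hia
  -- From `i = c a` and `j = (1 - c) a` with `i j = 0`, the element `c` is idempotent, hence `0` or
  -- `1`. So `a` lies in `I` or in `J`, and this nonzerodivisor kills `x` or `y`.
  have hc : c * (1 - c) = 0 := by
    have e := hIJ (c * a) j hi hj
    have : (c * (1 - c)) * (a * a) = 0 := by
      rw [← e]; linear_combination (c * a) * hij.symm
    exact (mem_nonZeroDivisors_iff_right.1 (mul_mem ha ha)) _ this
  have hc' : IsUnit c ∨ IsUnit (1 - c) := IsLocalRing.isUnit_or_isUnit_one_sub_self c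
  rcases hc' with hc' | hc'
  · have : (1 : R) - c = 0 := (hc'.mul_right_eq_zero).1 hc
    have hj0 : j = 0 := by linear_combination hij + a * this
    have haI : a ∈ I := by
      have : c = 1 := by linear_combination -this
      simpa [this] using hi
    have := hIJ a x haI hxJ
    exact hx ((mem_nonZeroDivisors_iff_right.1 ha) x this)
  · have hc0 : c = 0 := (hc'.mul_left_eq_zero).1 hc
    have haJ : a ∈ J := by
      have : j = a := by rw [← hij, hc0]; ring
      exact this ▸ hj
    have := hIJ y a ((hI y).2 hyx) haJ
    exact hy0 ((mem_nonZeroDivisors_iff_right.1 ha) y (by rw [mul_comm]; exact this))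

end Depth

/-! ### Depth of `T/(f)` -/

section HypersurfaceDepth

open Function

variable {T : Type u} [CommRing T] [IsRegularLocalRing T]

/-- `Tor` vanishing for an extension of `X` by multiplication by a regular element. -/
lemma subsingleton_torModule_of_exact {A : Type u} [CommRing A] {K F M : Type u} [AddCommGroup K]
    [Module A K] [AddCommGroup F] [Module A F] [AddCommGroup M] [Module A M] {f : K →ₗ[A] F}
    {g : F →ₗ[A] M} (hf : Injective f) (hg : Surjective g) (h : Exact f g)
    (N : Type u) [AddCommGroup N] [Module A N] (i : ℕ)
    (h1 : Subsingleton (torModule A F N (i + 1))) (h2 : Subsingleton (torModule A K N i)) :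
    Subsingleton (torModule A M N (i + 1)) := by
  obtain ⟨α, β, δ, -, -, -, h₂, -, -⟩ := exists_tor_long_exact hf hg h N
  refine ⟨fun a b ↦ ?_⟩
  rw [← sub_eq_zero]
  obtain ⟨z, hz⟩ := (h₂ i (a - b)).1 (Subsingleton.elim _ _)
  rw [← hz, Subsingleton.elim z 0, map_zero]

/-- Multiplication by `f` gives a free resolution of `S` of length one. -/
lemma subsingleton_torModule_of_ker {S : Type u} [CommRing S]
    [Algebra T S] {f : T} (hf : f ≠ 0) (hs : Surjective (algebraMap T S))
    (hk : RingHom.ker (algebraMap T S) = Ideal.span {f})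
    (N : Type u) [AddCommGroup N] [Module T N] (i : ℕ) :
    Subsingleton (torModule T S N (i + 2)) := by
  have := isDomain_of_isRegularLocalRing T
  have hex : Exact (LinearMap.mulLeft T f) (Algebra.linearMap T S) := fun y ↦ by
    rw [Algebra.linearMap_apply, ← RingHom.mem_ker, hk, Ideal.mem_span_singleton]
    exact ⟨fun ⟨c, hc⟩ ↦ ⟨c, hc.symm⟩, fun ⟨c, hc⟩ ↦ ⟨c, hc.symm⟩⟩
  have hinj : Injective (LinearMap.mulLeft T f) := isSMulRegular_of_isDomain hf
  exact subsingleton_torModule_of_exact hinj hs hex N (i + 1)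
    (subsingleton_torModule_of_flat T N _) (subsingleton_torModule_of_flat T N i)

lemma algebraMap_mem_maximalIdeal {S : Type u} [CommRing S] [IsLocalRing S] [Algebra T S]
    (hs : Surjective (algebraMap T S)) {t : T} (ht : t ∈ maximalIdeal T) :
    algebraMap T S t ∈ maximalIdeal S := by
  have := IsLocalHom.of_surjective _ hs
  rw [mem_maximalIdeal, mem_nonunits_iff] at ht ⊢
  exact fun h ↦ ht (isUnit_of_map_unit _ _ h)

variable {S : Type u} [CommRing S] [IsLocalRing S] [Algebra T S] {f : T} {n : ℕ}

lemma eq_zero_of_maximalIdeal_mul (hf : f ≠ 0) (hs : Surjective (algebraMap T S))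
    (hk : RingHom.ker (algebraMap T S) = Ideal.span {f})
    (hn : ringKrullDim T = (n + 2 : ℕ)) (z : S)
    (hz : ∀ r ∈ maximalIdeal S, r * z = 0) : z = 0 := by
  have : Module.Finite T S := Module.Finite.of_surjective (Algebra.linearMap T S) hs
  refine eq_zero_of_subsingleton_torModule hn S
    (subsingleton_torModule_of_ker hf hs hk _ n) z fun t ht ↦ ?_
  rw [Algebra.smul_def]
  exact hz _ (algebraMap_mem_maximalIdeal hs ht)

/-- `X` plays the role of `S/(a)`, whose `Tor` over `T` vanishes from degree three on. Since `T` has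
dimension at least three, its top `Tor` vanishes and `X` has no socle. -/
lemma eq_zero_of_ker_eq_span (hf : f ≠ 0) (hs : Surjective (algebraMap T S))
    (hk : RingHom.ker (algebraMap T S) = Ideal.span {f})
    (hn : ringKrullDim T = (n + 3 : ℕ)) {a : S} (ha : IsSMulRegular S a)
    {X : Type u} [AddCommGroup X] [Module T X] {g : S →ₗ[T] X} (hg : Surjective g)
    (hgk : ∀ y, g y = 0 ↔ y ∈ Ideal.span {a}) (z : S)
    (hz : ∀ r ∈ maximalIdeal S, r * z ∈ Ideal.span {a}) : g z = 0 := by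
  have : Module.Finite T S := Module.Finite.of_surjective (Algebra.linearMap T S) hs
  have hex : Exact (LinearMap.mulLeft T a) g := fun y ↦ by
    rw [hgk, Ideal.mem_span_singleton]
    exact ⟨fun ⟨c, hc⟩ ↦ ⟨c, hc.symm⟩, fun ⟨c, hc⟩ ↦ ⟨c, hc.symm⟩⟩
  have hinj : Injective (LinearMap.mulLeft T a) := ha
  have htor : Subsingleton (torModule T X (ResidueField T) (n + 3)) :=
    subsingleton_torModule_of_exact hinj hg hex _ (n + 2)
      (subsingleton_torModule_of_ker hf hs hk _ (n + 1))
      (subsingleton_torModule_of_ker hf hs hk _ n)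
  have hfin : Module.Finite T X := Module.Finite.of_surjective g hg
  refine eq_zero_of_subsingleton_torModule hn _ htor _ fun t ht ↦ ?_
  rw [← map_smul, Algebra.smul_def]
  exact (hgk _).2 (hz _ (algebraMap_mem_maximalIdeal hs ht))

lemma mem_span_of_maximalIdeal_mul (hf : f ≠ 0) (hs : Surjective (algebraMap T S))
    (hk : RingHom.ker (algebraMap T S) = Ideal.span {f})
    (hn : ringKrullDim T = (n + 3 : ℕ)) {a : S}
    (ha : IsSMulRegular S a) (z : S)
    (hz : ∀ r ∈ maximalIdeal S, r * z ∈ Ideal.span {a}) : z ∈ Ideal.span {a} := by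
  let J : Submodule T S := (Ideal.span {a}).restrictScalars T
  have hJ (y : S) : J.mkQ y = 0 ↔ y ∈ Ideal.span {a} := Submodule.Quotient.mk_eq_zero J
  exact (hJ z).1 (eq_zero_of_ker_eq_span hf hs hk hn ha (Submodule.mkQ_surjective J) hJ z hz)

end HypersurfaceDepth

/-! ### Nonzero elements of the hypersurface are regular -/

section NonZeroDivisor

open Function

theorem mem_nonZeroDivisors_of_isHypersurface {R : Type u} [CommRing R] (hR : IsHypersurface R)
    (hsing : HasIsolatedSingularity R) (hdim : 2 ≤ ringKrullDim R) {x : R} (hx : x ≠ 0) :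
    x ∈ nonZeroDivisors R := by
  obtain ⟨d, hd⟩ := exists_ringKrullDim_eq R
  obtain ⟨T, iT, iT', f, a, hf, hs, hk⟩ := exists_regular_presentation hR
  obtain ⟨-, hd1⟩ := ringKrullDim_presentation hR hf hs hk hd
  have hff : Module.FaithfullyFlat R (AdicCompletion (maximalIdeal R) R) :=
    Module.FaithfullyFlat.of_flat_of_isLocalHom
  have hinj : Injective (algebraMap R (AdicCompletion (maximalIdeal R) R)) :=
    FaithfulSMul.algebraMap_injective _ _
  by_cases hf0 : f = 0
  · have := isDomain_of_isRegularLocalRing T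
    have hinjT : Injective (algebraMap T (AdicCompletion (maximalIdeal R) R)) := by
      rw [RingHom.injective_iff_ker_eq_bot, hk, hf0, Ideal.span_singleton_zero]
    have : IsDomain (AdicCompletion (maximalIdeal R) R) :=
      (RingEquiv.ofBijective _ ⟨hinjT, hs⟩).symm.toMulEquiv.isDomain T
    have : IsDomain R := hinj.isDomain _
    exact mem_nonZeroDivisors_of_ne_zero hx
  · have hd2 : 2 ≤ d := by rw [hd] at hdim; exact_mod_cast hdim
    obtain ⟨d, rfl⟩ : ∃ d', d = d' + 2 := ⟨d - 2, by omega⟩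
    have hmap := AdicCompletion.maximalIdeal_eq_map (R := R)
    -- The maximal ideal of the completion is generated by that of `R`, so the socle conditions need
    -- testing only on elements of `R`.
    have key (z : R) (J : Ideal (AdicCompletion (maximalIdeal R) R))
        (hz : ∀ r ∈ maximalIdeal R, algebraMap R (AdicCompletion (maximalIdeal R) R) (r * z) ∈ J)
        (s)
        (hsm : s ∈ maximalIdeal (AdicCompletion (maximalIdeal R) R)) :
        s * algebraMap R (AdicCompletion (maximalIdeal R) R) z ∈ J := by
      have hle : (maximalIdeal R).map (algebraMap R (AdicCompletion (maximalIdeal R) R)) ≤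
          Submodule.comap (LinearMap.mulRight (AdicCompletion (maximalIdeal R) R)
            (algebraMap R (AdicCompletion (maximalIdeal R) R) z)) J := by
        rw [Ideal.map_le_iff_le_comap]
        intro r hr
        have := hz r hr
        rwa [map_mul] at this
      rw [hmap] at hsm
      exact hle hsm
    refine mem_nonZeroDivisors_of_punctured (fun z hz ↦ ?_) (fun b hb hbm z hz ↦ ?_) ?_ hx
    · apply hinj
      rw [map_zero]
      refine eq_zero_of_maximalIdeal_mul hf0 hs hk (hd1 hf0) _ fun s hsm ↦ ?_
      simpa using key z ⊥ (fun r hr ↦ by simp [hz r hr]) s hsm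
    · have hb' : IsSMulRegular (AdicCompletion (maximalIdeal R) R)
          (algebraMap R (AdicCompletion (maximalIdeal R) R) b) := by
        intro u v huv
        refine Module.Flat.isSMulRegular_of_nonZeroDivisors
          (M := AdicCompletion (maximalIdeal R) R) hb ?_
        simpa [Algebra.smul_def] using huv
      have := mem_span_of_maximalIdeal_mul hf0 hs hk (hd1 hf0) hb'
        (algebraMap R (AdicCompletion (maximalIdeal R) R) z)
        (key z (Ideal.span {algebraMap R (AdicCompletion (maximalIdeal R) R) b}) fun r hr ↦ by
          obtain ⟨c, hc⟩ := Ideal.mem_span_singleton'.1 (hz r hr)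
          rw [← hc, map_mul]
          exact Ideal.mem_span_singleton'.2 ⟨_, rfl⟩)
      rw [← Ideal.comap_map_eq_self_of_faithfullyFlat
        (B := AdicCompletion (maximalIdeal R) R) (Ideal.span {b}), Ideal.mem_comap, Ideal.map_span,
        Set.image_singleton]
      exact this
    · intro p hp hpm
      have : IsRegularLocalRing (Localization.AtPrime p) := by
        by_contra hcon
        exact hpm (IsLocalRing.eq_maximalIdeal (hsing ⟨p, hp⟩ hcon))
      exact isDomain_of_isRegularLocalRing _

end NonZeroDivisor

/-! ### Length count -/

section Length

open Function

lemma length_eq_ker_add_range {B : Type*} [CommRing B] {P Q : Type*} [AddCommGroup P] [Module B P]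
    [AddCommGroup Q] [Module B Q] (f : P →ₗ[B] Q) :
    Module.length B P = Module.length B (LinearMap.ker f) + Module.length B (LinearMap.range f) :=
  Module.length_eq_add_of_exact (LinearMap.ker f).subtype f.rangeRestrict
    (Submodule.subtype_injective _) f.surjective_rangeRestrict fun y ↦ by
      rw [← LinearMap.mem_ker, LinearMap.ker_rangeRestrict]
      simp

lemma length_add_length_of_exact {B : Type*} [CommRing B] {P₁ P₂ P₃ P₄ X : Type*}
    [AddCommGroup P₁] [Module B P₁] [AddCommGroup P₂] [Module B P₂] [AddCommGroup P₃] [Module B P₃]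
    [AddCommGroup P₄] [Module B P₄] [AddCommGroup X] [Module B X] {γ : P₄ →ₗ[B] P₂}
    {α : P₂ →ₗ[B] X} {β : X →ₗ[B] P₃} {δ : P₃ →ₗ[B] P₁} (h₁ : Exact γ α) (h₂ : Exact α β)
    (h₃ : Exact β δ) :
    Module.length B P₂ + Module.length B P₃ = Module.length B X +
      (Module.length B (LinearMap.range γ) + Module.length B (LinearMap.range δ)) := by
  rw [length_eq_ker_add_range α, length_eq_ker_add_range β, length_eq_ker_add_range δ,
    h₁.linearMap_ker_eq, h₂.linearMap_ker_eq, h₃.linearMap_ker_eq]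
  abel

lemma length_eq_of_addEquiv {A B : Type*} [CommRing A] [CommRing B] [Algebra A B]
    (hs : Surjective (algebraMap A B)) {X Y : Type*} [AddCommGroup X] [Module B X] [AddCommGroup Y]
    [Module A Y] (ε : X ≃+ Y) (hε : ∀ (a : A) x, ε (algebraMap A B a • x) = a • ε x) :
    Module.length B X = Module.length A Y := by
  let _ : Module A X := Module.compHom X (algebraMap A B)
  have : IsScalarTower A B X := ⟨fun a b x ↦ by
    rw [Algebra.smul_def, mul_smul]; rfl⟩
  rw [← Module.length_eq_of_surjective hs (M := X)]
  exact LinearEquiv.length_eq { ε with map_smul' := hε }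

/-- If `p i + p (i + 1) = r (i + 1) + (u (i + 1) + u i)` for two sequences `p`, `r` of period two,
then `r` is constant. -/
lemma eq_of_periodic {p r u : ℕ → ℕ} (h : ∀ i, p i + p (i + 1) = r (i + 1) + (u (i + 1) + u i))
    (hp : ∀ i, p (i + 2) = p i) (hr : ∀ i, r (i + 2) = r i) : r 1 = r 0 := by
  have hr' (i : ℕ) : r (2 * i) = r 0 ∧ r (2 * i + 1) = r 1 := by
    induction i with
    | zero => simp
    | succ i ih => exact ⟨(hr _).trans ih.1, (hr _).trans ih.2⟩
  -- Comparing the relation at `i` and at `i + 1` eliminates `p`, leaving a constant drift of `u`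
  -- with opposite signs on even and odd indices.
  have step (i : ℕ) : u i + r (i + 1) = u (i + 2) + r (i + 2) := by
    have e₁ := h i
    have e₂ := h (i + 1)
    have e₃ := hp i
    have e₄ : u (i + 1 + 1) = u (i + 2) := rfl
    have e₅ : p (i + 1 + 1) = p (i + 2) := rfl
    have e₆ : r (i + 1 + 1) = r (i + 2) := rfl
    omega
  have even (k : ℕ) : (u (2 * k) : ℤ) = u 0 + k * ((r 1 : ℤ) - r 0) := by
    induction k with
    | zero => simp
    | succ k ih =>
      have e₁ := step (2 * k)
      rw [(hr' k).2, show 2 * k + 2 = 2 * (k + 1) by ring, (hr' (k + 1)).1] at e₁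
      push_cast
      zify at e₁
      linear_combination ih - e₁
  have odd (k : ℕ) : (u (2 * k + 1) : ℤ) = u 1 - k * ((r 1 : ℤ) - r 0) := by
    induction k with
    | zero => simp
    | succ k ih =>
      have e₁ := step (2 * k + 1)
      rw [show 2 * k + 1 + 1 = 2 * (k + 1) by ring, (hr' (k + 1)).1,
        show 2 * k + 1 + 2 = 2 * (k + 1) + 1 by ring, (hr' (k + 1)).2] at e₁
      push_cast
      zify at e₁
      linear_combination ih - e₁
  by_contra hne
  rcases lt_or_gt_of_ne hne with hlt | hlt
  · have := even (u 0 + 1)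
    push_cast at this
    nlinarith
  · have := odd (u 1 + 1)
    push_cast at this
    nlinarith

/-- Over a hypersurface with isolated singularity, high `Tor` modules of modules over a hypersurface
section all have the same length. -/
theorem length_torModule_succ_eq {R : Type u} [CommRing R] (hR : IsHypersurface R)
    (hsing : HasIsolatedSingularity R) {d : ℕ} (hd : ringKrullDim R = d) {x : R}
    (hreg : IsSMulRegular R x) (hRx : IsHypersurface (R ⧸ Ideal.span {x}))
    (hxsing : HasIsolatedSingularity (R ⧸ Ideal.span {x}))
    (M N : Type u) [AddCommGroup M] [Module R M] [Module.Finite R M]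
    [AddCommGroup N] [Module R N] [Module.Finite R N] (hM : ∀ m : M, x • m = 0)
    (hN : ∀ n : N, x • n = 0) (i : ℕ) (hi : d ≤ i) :
    (Module.length R (torModule R M N (i + 2))).toNat =
      (Module.length R (torModule R M N (i + 1))).toNat := by
  have hper (j : ℕ) (hj : d ≤ j) := torModule_of_isHypersurface hR hsing hd M N j hj
  have hr (k j : ℕ) (hj : d ≤ j) : Module.length R (torModule R M N (j + 1 + 2 * k)) =
      Module.length R (torModule R M N (j + 1)) := by
    induction k with
    | zero => rfl
    | succ k ih =>
      obtain ⟨e⟩ := (hper (j + 2 * k) (by omega)).2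
      rw [← ih]
      have := e.length_eq
      rwa [show j + 2 * k + 3 = j + 1 + 2 * (k + 1) by ring,
        show j + 2 * k + 1 = j + 1 + 2 * k by ring] at this
  obtain ⟨d', hd'⟩ := exists_ringKrullDim_eq (R ⧸ Ideal.span {x})
  have hMt : Module.IsTorsionBySet R M (Ideal.span {x} : Ideal R) :=
    (Module.isTorsionBySet_span_singleton_iff x).2 fun m ↦ hM m
  have hNt : Module.IsTorsionBySet R N (Ideal.span {x} : Ideal R) :=
    (Module.isTorsionBySet_span_singleton_iff x).2 fun m ↦ hN m
  let _ : Module (R ⧸ Ideal.span {x}) M := hMt.module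
  let _ : Module (R ⧸ Ideal.span {x}) N := hNt.module
  have _ : IsScalarTower R (R ⧸ Ideal.span {x}) M := hMt.isScalarTower
  have _ : IsScalarTower R (R ⧸ Ideal.span {x}) N := hNt.isScalarTower
  have _ : Module.Finite (R ⧸ Ideal.span {x}) M := Module.Finite.of_restrictScalars_finite R _ _
  have _ : Module.Finite (R ⧸ Ideal.span {x}) N := Module.Finite.of_restrictScalars_finite R _ _
  have hper' (j : ℕ) (hj : d' ≤ j) := torModule_of_isHypersurface hRx hxsing hd' M N j hj
  obtain ⟨hs, hk⟩ := surjective_and_ker_quotient x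
  obtain ⟨X, ε, α, β, δ, hε, h₁, h₂, h₃⟩ := exists_changeOfRings_exact hs hk hreg M N
  have fin₁ (j : ℕ) (hj : d + 1 ≤ j) : Module.length R (torModule R M N j) ≠ ⊤ := by
    obtain ⟨j, rfl⟩ : ∃ j', j = j' + 1 := ⟨j - 1, by omega⟩
    exact Module.length_ne_top_iff.2 (hper j (by omega)).1
  have fin₂ (j : ℕ) (hj : d' + 1 ≤ j) :
      Module.length (R ⧸ Ideal.span {x}) (torModule (R ⧸ Ideal.span {x}) M N j) ≠ ⊤ := by
    obtain ⟨j, rfl⟩ : ∃ j', j = j' + 1 := ⟨j - 1, by omega⟩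
    exact Module.length_ne_top_iff.2 (hper' j (by omega)).1
  have fin₃ (j : ℕ) (hj : d' ≤ j) :
      Module.length (R ⧸ Ideal.span {x}) (LinearMap.range (δ j)) ≠ ⊤ :=
    ne_top_of_le_ne_top (fin₂ (j + 1) (by omega))
      (Module.length_le_of_injective _ (Submodule.subtype_injective _))
  have hlen (j : ℕ) := (length_add_length_of_exact (h₃ (j + 1)) (h₁ (j + 1)) (h₂ j))
  -- The offset `d + d'` places all indices in the range where both `Tor` sequences are periodic and
  -- of finite length.
  have key := eq_of_periodic
    (p := fun j ↦ (Module.length (R ⧸ Ideal.span {x})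
      (torModule (R ⧸ Ideal.span {x}) M N (d + d' + j + 2))).toNat)
    (r := fun j ↦ (Module.length R (torModule R M N (d + d' + j + 2))).toNat)
    (u := fun j ↦ (Module.length (R ⧸ Ideal.span {x}) (LinearMap.range (δ (d + d' + j)))).toNat)
    (fun j ↦ by
      rw [← ENat.toNat_add (fin₂ _ (by omega)) (fin₂ _ (by omega)),
        ← ENat.toNat_add (fin₃ _ (by omega)) (fin₃ _ (by omega)),
        ← ENat.toNat_add (fin₁ (d + d' + (j + 1) + 2) (by omega))
          (fun h ↦ (ENat.add_eq_top.1 h).elim (fin₃ _ (by omega)) (fin₃ _ (by omega)))]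
      congr 1
      refine (hlen (d + d' + j)).trans ?_
      rw [length_eq_of_addEquiv hs (ε (d + d' + j + 1)) (hε _)]
      rfl)
    (fun j ↦ by
      obtain ⟨e⟩ := (hper' (d + d' + j + 1) (by omega)).2
      exact congrArg ENat.toNat e.length_eq)
    (fun j ↦ by
      obtain ⟨e⟩ := (hper (d + d' + j + 1) (by omega)).2
      exact congrArg ENat.toNat e.length_eq)
  have key' : (Module.length R (torModule R M N (d + d' + 3))).toNat =
      (Module.length R (torModule R M N (d + d' + 2))).toNat := key
  have hn (n : ℕ) (hn : d ≤ n) : (Module.length R (torModule R M N (n + 1))).toNat =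
      (Module.length R (torModule R M N (d + d' + 2))).toNat := by
    -- Raising the degree by an even amount moves it past `d + d' + 2` without changing the length;
    -- only its parity is then left to treat.
    rw [← hr (d + d' + 1) n hn]
    rcases Nat.even_or_odd' (n + (d + d' + 1)) with ⟨k, hk | hk⟩
    · rw [show n + 1 + 2 * (d + d' + 1) = (d + d' + 1) + 1 + 2 * k by omega, hr _ _ (by omega)]
    · rw [show n + 1 + 2 * (d + d' + 1) = (d + d' + 2) + 1 + 2 * k by omega, hr _ _ (by omega),
        key']
  rw [hn i hi, hn (i + 1) (by omega)]

end Length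

end TorAux

theorem mainTheorem8 (R : Type u) [CommRing R] (hR : IsHypersurface R)
    (hsing : HasIsolatedSingularity R) (hdim : 2 ≤ ringKrullDim R)
    (M N : Type u) [AddCommGroup M] [Module R M] [Module.Finite R M]
    [AddCommGroup N] [Module R N] [Module.Finite R N]
    (x : R) (hx0 : x ≠ 0) (hx : x ∈ Module.annihilator R M ⊓ Module.annihilator R N)
    (hRx : IsHypersurface (R ⧸ Ideal.span {x}))
    (hxsing : HasIsolatedSingularity (R ⧸ Ideal.span {x})) :
    HochsterThetaIsDefined R M N ∧ hochsterTheta R M N = 0 := by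
  obtain ⟨d, hd⟩ := TorAux.exists_ringKrullDim_eq R
  have hreg : IsSMulRegular R x := fun a b hab ↦ by
    have h : (a - b) * x = 0 := by
      have : x * a = x * b := hab
      linear_combination this
    exact sub_eq_zero.1 ((mem_nonZeroDivisors_iff_right.1
      (TorAux.mem_nonZeroDivisors_of_isHypersurface hR hsing hdim hx0)) _ h)
  have hfin (j : ℕ) (hj : d ≤ j) : IsFiniteLength R (torModule R M N (j + 1)) :=
    (TorAux.torModule_of_isHypersurface hR hsing hd M N j hj).1
  -- Vanishing for every such `e` yields both the independence of `e` and the value at `e = d + 1`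
  -- that defines `hochsterTheta`.
  have hzero (e : ℕ) (he : d ≤ 2 * e) : torLengthDifference R M N e = 0 := by
    rw [torLengthDifference, TorAux.length_torModule_succ_eq hR hsing hd hreg hRx hxsing M N
      (Module.mem_annihilator.1 hx.1) (Module.mem_annihilator.1 hx.2) (2 * e) he, sub_self]
  have htheta : hochsterTheta R M N = 0 := hzero _ <| by
    rw [hd]
    change d ≤ 2 * (d + 1)
    omega
  have hle {e : ℕ} (he : ringKrullDim R + 2 ≤ ((2 * e : ℕ) : WithBot ℕ∞)) : d ≤ 2 * e := by
    rw [hd] at he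
    have : d + 2 ≤ 2 * e := by exact_mod_cast he
    omega
  exact ⟨{
    eventually_isFiniteLength := ⟨d + 1, fun j hj ↦ by
      obtain ⟨j, rfl⟩ : ∃ j', j = j' + 1 := ⟨j - 1, by omega⟩
      exact hfin j (by omega)⟩
    isFiniteLength_odd := fun e he ↦ hfin _ (hle he)
    isFiniteLength_even := fun e he ↦ hfin _ ((hle he).trans (Nat.le_succ _))
    torLengthDifference_eq := fun e he ↦ by rw [hzero e (hle he), htheta] }, htheta⟩
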